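/- Let $\alpha,\sigma_R^2,\sigma_D^2,P_S,P_R>0$ and consider the (normalized) two-hop full-duplex relay channel with residual self-interference $$Y_R=X_S+I+N_R,\qquad Y_D=X_R+N_D,$$ where $N_R\sim\mathcal N(0,\sigma_R^2)$ and $N_D\sim\mathcal N(0,\sigma_D^2)$ are independent noises and, given $X_R=x_R$, $I\sim\mathcal N(0,\alpha x_R^2)$ independently of everything else ($I=G X_R$ with $G\sim\mathcal N(0,\alpha)$). All symbol intervals are independent and rates are in bits. Let $$C=\sup_{p(x_R)}\min\Big\{\sup_{p(x_S|x_R)} I(X_S;Y_R|X_R),\ I(X_R;Y_D)\Big\}\quad\text{subject to } E\{X_S^2\}\le P_S,\ E\{X_R^2\}\le P_R ,$$ and let $p^*$ be a law of $X_R$ that attains this supremum. Let $x_{\rm th}>0$ be such that $E_{p^*}\{P_S(X_R)\}=P_S$, where $P_S(x_R)=\alpha\max\{0,x_{\rm th}^2-x_R^2\}$, and let $p_T=\Pr_{p^*}\{|X_R|<x_{\rm th}\}$. Let $R=C-\epsilon$ with $\epsilon>0$. The source's codebook maps each binary sequence of $\lceil kR\rceil$ bits (of $0$ bits if $R\le 0$)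 to a codeword of $n=\lfloor kp_T\rfloor$ symbols; all symbols of all codewords are independent and $\mathcal N(0,1)$. In the first time slot, of $k$ symbol intervals, a uniformly distributed message is mapped to its codeword $\mathbf x_S(1)$, the source sends each symbol of it amplified by $\sqrt{P_S(0)}=\sqrt{\alpha}\,x_{\rm th}$ in the first $n$ intervals, and the relay is silent ($X_R=0$ in all $k$ intervals). The relay forms $\mathbf y_R(1)$ from the first $n$ received symbols and uses the jointly $\delta$-typical decoder: it outputs the message whose codeword is jointly $\delta$-typical with $\mathbf y_R(1)$ if there is exactly one, and otherwise declares an error. Joint $\delta$-typicality of $(\mathbf x,\mathbf y)$ means that the three normalized negative logarithms $-\frac1n\log_2 f_X(\mathbf x)$, $-\frac1n\log_2 f_Y(\mathbf y)$, $-\frac1n\log_2 f_{XY}(\mathbf x,\mathbf y)$ of the product densities differ by less than $\delta$ from the differential entropies $h(X),h(Y),h(X,Y)$, where $X\sim\mathcal N(0,1)$ and $Y=\sqrt{P_S(0)}\,X+N_R$ with $N_R$ independent of $X$. Then $C<\infty$, $$R<\max_{p(x_S|x_R=0)} I(X_S;Y_R|X_R=0)\,p_T=\frac12\log_2\Big(1+\frac{\alpha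 x_{\rm th}^2}{\sigma_R^2}\Big)p_T ,$$ where the maximum is over all laws of $X_S$ with $E\{X_S^2\}\le P_S(0)$ and is attained, and the codeword $\mathbf x_S(1)$ is decoded successfully by the relay: there is $\delta_0>0$ such that for every $0<\delta<\delta_0$ the probability (over codebook, message, interference and noise) that the decoder does not output the sent message tends to $0$ as $k\to\infty$. -/

import Mathlib

open MeasureTheory ProbabilityTheory InformationTheory Filter Topology
open scoped ENNReal NNReal

noncomputable section

/-! ### Mutual informations and the capacity

Everything refers to the normalized two-hop full-duplex relay channel
`Y_R = X_S + G * X_R + N_R`, `Y_D = X_R + N_D`, with independent `G ∼ N(0, α)` (normalized random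
self-interference gain), `N_R ∼ N(0, σR2)`, `N_D ∼ N(0, σD2)`. Given `X_R = x`, the residual
self-interference `I = G * x` is `N(0, α x²)`. All informations are in bits. -/

/-- Mutual information, in bits, of a pair of random variables with joint law `ρ`. -/
def mutualInfoBits {A B : Type*} [MeasurableSpace A] [MeasurableSpace B]
    (ρ : Measure (A × B)) : ℝ≥0∞ :=
  klDiv ρ ((ρ.map Prod.fst).prod (ρ.map Prod.snd)) / ENNReal.ofReal (Real.log 2)

/-- Joint law of `(X_S, Y_R)` given `X_R = x`, when `X_S` has law `p` given `X_R = x`. -/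
def sourceRelayLaw (α σR2 : ℝ≥0) (x : ℝ) (p : Measure ℝ) : Measure (ℝ × ℝ) :=
  (p.prod ((gaussianReal 0 α).prod (gaussianReal 0 σR2))).map
    (fun t => (t.1, t.1 + t.2.1 * x + t.2.2))

/-- `I(X_S; Y_R | X_R = x)` when `X_S` has law `p` given `X_R = x`. -/
def sourceRelayInfoAt (α σR2 : ℝ≥0) (x : ℝ) (p : Measure ℝ) : ℝ≥0∞ :=
  mutualInfoBits (sourceRelayLaw α σR2 x p)

/-- `max I(X_S; Y_R | X_R)` over all conditional laws `κ = p(x_S | x_R)` with `E[X_S²] ≤ P_S`,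
when `X_R` has law `ν`. -/
def sourceRelayRate (α σR2 PS : ℝ≥0) (ν : Measure ℝ) : ℝ≥0∞ :=
  ⨆ (κ : Kernel ℝ ℝ) (_ : IsMarkovKernel κ)
    (_ : ∫⁻ x, ∫⁻ s, ENNReal.ofReal (s ^ 2) ∂(κ x) ∂ν ≤ (PS : ℝ≥0∞)),
    ∫⁻ x, sourceRelayInfoAt α σR2 x (κ x) ∂ν

/-- `I(X_R; Y_D)` when `X_R` has law `ν`. -/
def relayDestInfo (σD2 : ℝ≥0) (ν : Measure ℝ) : ℝ≥0∞ :=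
  mutualInfoBits ((ν.prod (gaussianReal 0 σD2)).map (fun t => (t.1, t.1 + t.2)))

/-- The capacity: the supremum of `min {max I(X_S; Y_R | X_R), I(X_R; Y_D)}` over all laws `ν` of
`X_R` with `E[X_R²] ≤ P_R`. -/
def relayCapacity (α σR2 σD2 PS PR : ℝ≥0) : ℝ≥0∞ :=
  ⨆ (ν : Measure ℝ) (_ : IsProbabilityMeasure ν)
    (_ : ∫⁻ x, ENNReal.ofReal (x ^ 2) ∂ν ≤ (PR : ℝ≥0∞)),
    min (sourceRelayRate α σR2 PS ν) (relayDestInfo σD2 ν)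

/-- `ν` is an optimal input distribution at the relay. -/
def IsOptimalRelayInput (α σR2 σD2 PS PR : ℝ≥0) (ν : Measure ℝ) : Prop :=
  ∫⁻ x, ENNReal.ofReal (x ^ 2) ∂ν ≤ (PR : ℝ≥0∞) ∧
    min (sourceRelayRate α σR2 PS ν) (relayDestInfo σD2 ν) = relayCapacity α σR2 σD2 PS PR

/-- The source's power allocation `P_S(x_R) = α max {0, x_th² - x_R²}`. -/
def sourcePower (α : ℝ≥0) (xth x : ℝ) : ℝ := α * max 0 (xth ^ 2 - x ^ 2)

/-- `p_T = Pr {|X_R| < x_th}` when `X_R` has law `ν`. -/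
def transmitProb (ν : Measure ℝ) (xth : ℝ) : ℝ := ν.real {x | |x| < xth}

/-- The number `⌊k p_T⌋` of symbols in a codeword of the source. -/
def blockLength (ν : Measure ℝ) (xth : ℝ) (k : ℕ) : ℕ := ⌊(k : ℝ) * transmitProb ν xth⌋₊

lemma blockLength_le (ν : Measure ℝ) [IsProbabilityMeasure ν] (xth : ℝ) (k : ℕ) :
    blockLength ν xth k ≤ k := by
  refine Nat.floor_le_of_le ?_
  exact mul_le_of_le_one_right (Nat.cast_nonneg k) measureReal_le_one

/-! ### Joint typicality with respect to a joint density -/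

/-- First marginal of the joint density `f`. -/
def margFst (f : ℝ → ℝ → ℝ) (x : ℝ) : ℝ := ∫ y, f x y

/-- Second marginal of the joint density `f`. -/
def margSnd (f : ℝ → ℝ → ℝ) (y : ℝ) : ℝ := ∫ x, f x y

/-- Differential entropy, in bits, of the density `g` with respect to Lebesgue measure. -/
def diffEntropyBits {E : Type*} [MeasureSpace E] (g : E → ℝ) : ℝ :=
  -∫ z, g z * Real.logb 2 (g z)

/-- `(x, y) ∈ ℝⁿ × ℝⁿ` is jointly `δ`-typical for the joint density `f`: the three empirical
entropies are `δ`-close to the differential entropies `h(X)`, `h(Y)` and `h(X, Y)`. -/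
def JointlyTypical (f : ℝ → ℝ → ℝ) (δ : ℝ) {n : ℕ} (x y : Fin n → ℝ) : Prop :=
  |-(1 / (n : ℝ)) * Real.logb 2 (∏ i, margFst f (x i)) - diffEntropyBits (margFst f)| < δ ∧
  |-(1 / (n : ℝ)) * Real.logb 2 (∏ i, margSnd f (y i)) - diffEntropyBits (margSnd f)| < δ ∧
  |-(1 / (n : ℝ)) * Real.logb 2 (∏ i, f (x i) (y i))
      - diffEntropyBits (fun p : ℝ × ℝ => f p.1 p.2)| < δ

open Classical in
/-- The typical decoder: it outputs the message whose codeword is jointly typical with the received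
word `y`, if there is exactly one, and otherwise declares an error (`none`). -/
def typicalDecoder (f : ℝ → ℝ → ℝ) (δ : ℝ) {M : Type*} {n : ℕ} (c : M → Fin n → ℝ)
    (y : Fin n → ℝ) : Option M :=
  if h : ∃! w, JointlyTypical f δ (c w) y then some h.choose else none

/-! ### The first time slot -/

/-- The messages: binary sequences of `⌈k R⌉` bits. -/
abbrev Message (k : ℕ) (R : ℝ) : Type := Fin ⌈(k : ℝ) * R⌉₊ → Bool

/-- Law of the random codebook with message set `M` and codewords of length `n`: all symbols are
independent and `N(0, 1)`. -/
def codebookLaw (M : Type*) [Fintype M] (n : ℕ) : Measure (M → Fin n → ℝ) :=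
  Measure.pi fun _ => Measure.pi fun _ => gaussianReal 0 1

/-- Symbols sent by the source in the `k` intervals of the first slot: the codeword `x`, amplified
by `√P_S(0)`, and then silence. -/
def firstSlotSource (α : ℝ≥0) (xth : ℝ) (k : ℕ) {n : ℕ} (x : Fin n → ℝ) : Fin k → ℝ :=
  fun i => if h : (i : ℕ) < n then Real.sqrt (sourcePower α xth 0) * x ⟨i, h⟩ else 0

/-- Symbols sent by the relay in the first slot: it is silent. -/
def firstSlotRelay (k : ℕ) : Fin k → ℝ := fun _ => 0

/-- Symbols received at the relay when the source sends `xS`, the relay sends `xR`, the normalized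
self-interference gains are `g` and the noise is `z`. -/
def relayReceived {k : ℕ} (xS xR g z : Fin k → ℝ) : Fin k → ℝ :=
  fun i => xS i + g i * xR i + z i

/-- Joint density, in one interval of the first slot, of the codeword symbol `X ∼ N(0, 1)` and
the received symbol, which is `N(√P_S(0) x, σR2)` given `X = x`. -/
def firstSlotDensity (α σR2 : ℝ≥0) (xth : ℝ) (x y : ℝ) : ℝ :=
  gaussianPDFReal 0 1 x * gaussianPDFReal (Real.sqrt (sourcePower α xth 0) * x) σR2 y

/-- Law of the randomness of the first slot: random codebook, self-interference gains and noise
at the relay, all independent. -/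
def firstSlotLaw (α σR2 : ℝ≥0) (k n : ℕ) (M : Type*) [Fintype M] :
    Measure ((M → Fin n → ℝ) × (Fin k → ℝ) × (Fin k → ℝ)) :=
  (codebookLaw M n).prod ((Measure.pi fun _ => gaussianReal 0 α).prod
    (Measure.pi fun _ => gaussianReal 0 σR2))

/-- Event that message `w` is sent and the relay's typical decoder, applied to the first `n` of
the `k` received symbols, does not output `w`. -/
def firstSlotError (α σR2 : ℝ≥0) (xth δ : ℝ) {k n : ℕ} (hn : n ≤ k) {M : Type*} (w : M) :
    Set ((M → Fin n → ℝ) × (Fin k → ℝ) × (Fin k → ℝ)) :=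
  {ω | typicalDecoder (firstSlotDensity α σR2 xth) δ ω.1
      (fun j => relayReceived (firstSlotSource α xth k (ω.1 w)) (firstSlotRelay k) ω.2.1 ω.2.2
        (Fin.castLE hn j)) ≠ some w}

/-- Error probability in the first slot, for a uniformly distributed message. -/
def firstSlotErrorProb (α σR2 : ℝ≥0) (xth δ : ℝ) {k n : ℕ} (hn : n ≤ k) (M : Type*)
    [Fintype M] : ℝ :=
  (∑ w : M, (firstSlotLaw α σR2 k n M).real (firstSlotError α σR2 xth δ hn w)) / Fintype.card M

end

/-! ### Relative entropy -/

/-! Two facts combine: a strict gap between `R` and the first-slot rate, and random coding below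
that rate.

The gap comes from water-filling. Given `X_R = x`, the first hop is an additive Gaussian channel of
noise variance `α x² + σR2`, so input power `q` yields at most `1/2 log₂ (1 + q / (α x² + σR2))`
bits. The power `P_S(x)` fills the noise up to the level `α xth² + σR2` when `|x| < xth` and
vanishes elsewhere. The tangent to the concave rate at `P_S(x)` (`waterfilling_tangent`), integrated
over `x` (`sourceRelayRate_le`), shows that no allocation of mean power `PS` does better. Noise is
least and power greatest at `x = 0`, so the mean rate is at most the rate at `0` times `p_T`.
Optimality of `ν` bounds the capacity by this number, and `R` is smaller by at least `ε`.

The Gaussian bound for arbitrary inputs follows from the chain rule for relative entropy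
(`klDiv_prod_eq_add`): mutual information plus the divergence of the output from a reference
Gaussian depends only on the second moment of the input.

For decoding, the sent codeword fails to be typical with probability `O(1/n)` by Chebyshev. An
independent codeword is typical with probability at most `2 ^ (-n (I - 3δ))` by Markov's inequality
for a likelihood ratio of mean one. The union bound over `2 ^ ⌈kR⌉₊` messages
(`firstSlotErrorProb_le`) tends to `0`, since `n ≈ k p_T` and `R < I p_T`. -/

lemma klDiv_map_measurableEquiv {A B : Type*} [MeasurableSpace A] [MeasurableSpace B]
    (μ ν : Measure A) [IsFiniteMeasure μ] [IsFiniteMeasure ν] (e : A ≃ᵐ B) :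
    klDiv (μ.map e) (ν.map e) = klDiv μ ν := by
  refine le_antisymm (klDiv_map_le μ ν e.measurable) ?_
  have h := klDiv_map_le (μ.map e) (ν.map e) e.symm.measurable
  rwa [Measure.map_map e.symm.measurable e.measurable,
    Measure.map_map e.symm.measurable e.measurable, e.symm_comp_self, Measure.map_id,
    Measure.map_id] at h

lemma klDiv_prod_swap {A B : Type*} [MeasurableSpace A] [MeasurableSpace B]
    (ρ : Measure (A × B)) [IsFiniteMeasure ρ] (p : Measure A) (q : Measure B)
    [IsFiniteMeasure p] [IsFiniteMeasure q] :
    klDiv (ρ.map Prod.swap) (q.prod p) = klDiv ρ (p.prod q) := by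
  rw [← Measure.prod_swap (μ := p) (ν := q)]
  exact klDiv_map_measurableEquiv ρ (p.prod q) MeasurableEquiv.prodComm

/-- The relative entropy of a joint law with respect to a product of its first marginal exceeds
the mutual information by the relative entropy of the second marginals. -/
lemma klDiv_prod_eq_add {A B : Type*} [MeasurableSpace A] [MeasurableSpace B]
    [StandardBorelSpace A] [Nonempty A]
    (ρ : Measure (A × B)) [IsProbabilityMeasure ρ] (r : Measure B) [IsProbabilityMeasure r] :
    klDiv ρ (ρ.fst.prod r) = klDiv ρ.snd r + klDiv ρ (ρ.fst.prod ρ.snd) := by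
  rw [← klDiv_prod_swap ρ ρ.fst r, ← klDiv_prod_swap ρ ρ.fst ρ.snd]
  -- The chain rule splits off the divergence of the first marginals. After the swap these are the
  -- ones that differ, while the conditional comparison is with the same constant kernel on both
  -- sides.
  have : IsProbabilityMeasure (ρ.map Prod.swap) :=
    Measure.isProbabilityMeasure_map measurable_swap.aemeasurable
  have h := (ρ.map Prod.swap).disintegrate (ρ.map Prod.swap).condKernel
  rw [Measure.fst_map_swap] at h
  rw [← h, ← Measure.compProd_const, ← Measure.compProd_const, klDiv_compProd_eq_add]

/-! ### Additive Gaussian noise -/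

/-- Joint law of the input and the output of a channel with additive `N(0, v)` noise, when the
input has law `p`. -/
noncomputable def awgnLaw (p : Measure ℝ) (v : ℝ≥0) : Measure (ℝ × ℝ) :=
  (p.prod (gaussianReal 0 v)).map (fun t => (t.1, t.1 + t.2))

instance (p : Measure ℝ) [IsProbabilityMeasure p] (v : ℝ≥0) :
    IsProbabilityMeasure (awgnLaw p v) :=
  Measure.isProbabilityMeasure_map (by fun_prop)

lemma awgnLaw_fst (p : Measure ℝ) [IsProbabilityMeasure p] (v : ℝ≥0) : (awgnLaw p v).fst = p := by
  rw [awgnLaw, Measure.fst_map_prodMk (by fun_prop)]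
  exact Measure.fst_prod

lemma awgnLaw_snd (p : Measure ℝ) [IsProbabilityMeasure p] (v : ℝ≥0) :
    (awgnLaw p v).snd = p ∗ gaussianReal 0 v := by
  rw [awgnLaw, Measure.snd_map_prodMk (by fun_prop)]
  rfl

lemma measurable_gaussianPDF_div (v t : ℝ≥0) :
    Measurable fun z : ℝ × ℝ => gaussianPDF z.1 v z.2 / gaussianPDF 0 t z.2 := by
  have hm : Measurable fun z : ℝ × ℝ => gaussianPDF z.1 v z.2 :=
    measurable_uncurry_gaussianPDF.comp
      (g := fun p : ℝ × ℝ≥0 × ℝ => gaussianPDF p.1 p.2.1 p.2.2)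
      (f := fun z : ℝ × ℝ => (z.1, v, z.2)) (by fun_prop)
  exact hm.div ((measurable_gaussianPDF 0 t).comp measurable_snd)

/-- The input law need not have a density: only the output is compared with a reference,
conditionally on the input. -/
lemma awgnLaw_eq_withDensity (p : Measure ℝ) [IsProbabilityMeasure p] {v t : ℝ≥0} (hv : v ≠ 0)
    (ht : t ≠ 0) :
    awgnLaw p v = (p.prod (gaussianReal 0 t)).withDensity
      (fun z => gaussianPDF z.1 v z.2 / gaussianPDF 0 t z.2) := by
  have hm' := measurable_gaussianPDF_div v t
  refine Measure.ext_of_lintegral _ fun g hg => ?_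
  have e1 : ∫⁻ z, g z ∂(awgnLaw p v) = ∫⁻ x, ∫⁻ y, g (x, y) ∂(gaussianReal x v) ∂p := by
    rw [awgnLaw, lintegral_map hg (by fun_prop), lintegral_prod _ (by fun_prop)]
    refine lintegral_congr fun x => ?_
    have := gaussianReal_map_const_add (μ := 0) (v := v) x
    rw [zero_add] at this
    rw [← this, lintegral_map (by fun_prop) (by fun_prop)]
  have e2 : ∫⁻ z, g z ∂((p.prod (gaussianReal 0 t)).withDensity
      (fun z => gaussianPDF z.1 v z.2 / gaussianPDF 0 t z.2)) =
      ∫⁻ x, ∫⁻ y, gaussianPDF x v y / gaussianPDF 0 t y * g (x, y) ∂(gaussianReal 0 t) ∂p := by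
    rw [lintegral_withDensity_eq_lintegral_mul _ hm' hg, lintegral_prod _ (hm'.mul hg).aemeasurable]
    rfl
  rw [e1, e2]
  refine lintegral_congr fun x => ?_
  have m1 : Measurable fun y => g (x, y) := by fun_prop
  have m2 : Measurable fun y => gaussianPDF x v y / gaussianPDF 0 t y * g (x, y) :=
    ((measurable_gaussianPDF x v).div (measurable_gaussianPDF 0 t)).mul m1
  rw [gaussianReal_of_var_ne_zero _ hv, gaussianReal_of_var_ne_zero _ ht,
    lintegral_withDensity_eq_lintegral_mul _ (measurable_gaussianPDF _ _) m1,
    lintegral_withDensity_eq_lintegral_mul _ (measurable_gaussianPDF _ _) m2]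
  refine lintegral_congr fun y => ?_
  simp only [Pi.mul_apply]
  rw [← mul_assoc, ENNReal.mul_div_cancel (gaussianPDF_pos 0 ht y).ne' gaussianPDF_ne_top]

lemma log_gaussianPDFReal (m : ℝ) {v : ℝ≥0} (hv : v ≠ 0) (x : ℝ) :
    Real.log (gaussianPDFReal m v x)
      = -(1 / 2 * Real.log (2 * Real.pi * v)) - (x - m) ^ 2 / (2 * v) := by
  have hv' : (0 : ℝ) < v := by positivity
  rw [gaussianPDFReal, Real.log_mul (by positivity) (Real.exp_pos _).ne', Real.log_exp,
    Real.log_inv, Real.log_sqrt (by positivity)]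
  ring

lemma integral_sq_gaussianReal (v : ℝ≥0) : ∫ x, x ^ 2 ∂(gaussianReal 0 v) = v := by
  have h := variance_fun_id_gaussianReal (μ := 0) (v := v)
  rw [variance_eq_integral (by fun_prop)] at h
  simpa using h

/-- With a Gaussian reference output the log-likelihood ratio is quadratic in input and noise, and
the cross term has mean zero. Hence the answer sees the input only through its second moment. -/
lemma klDiv_awgnLaw_prod_gaussianReal (p : Measure ℝ) [IsProbabilityMeasure p] {v t : ℝ≥0}
    (hv : v ≠ 0) (ht : t ≠ 0) (hp : MemLp id 2 p) :
    klDiv (awgnLaw p v) (p.prod (gaussianReal 0 t)) = ENNReal.ofReal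
      (1 / 2 * Real.log (t / v) - 1 / 2 + (∫ x, x ^ 2 ∂p + v) / (2 * t)) := by
  have hv' : (0 : ℝ) < v := by positivity
  have ht' : (0 : ℝ) < t := by positivity
  have hac : awgnLaw p v ≪ p.prod (gaussianReal 0 t) := by
    rw [awgnLaw_eq_withDensity p hv ht]
    exact withDensity_absolutelyContinuous _ _
  have hm' := measurable_gaussianPDF_div v t
  set F : ℝ × ℝ → ℝ := fun z => 1 / 2 * Real.log (t / v) - (z.2 - z.1) ^ 2 / (2 * v)
    + z.2 ^ 2 / (2 * t) with hF
  have hllr : llr (awgnLaw p v) (p.prod (gaussianReal 0 t)) =ᵐ[awgnLaw p v] F := by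
    refine hac.ae_le ?_
    have h := Measure.rnDeriv_withDensity (p.prod (gaussianReal 0 t)) hm'
    rw [← awgnLaw_eq_withDensity p hv ht] at h
    filter_upwards [h] with z hz
    have h1 := gaussianPDFReal_pos z.1 v z.2 hv
    have h2 := gaussianPDFReal_pos 0 t z.2 ht
    rw [llr, hz, ENNReal.toReal_div, toReal_gaussianPDF, toReal_gaussianPDF,
      Real.log_div h1.ne' h2.ne', log_gaussianPDFReal _ hv, log_gaussianPDFReal _ ht, hF]
    rw [Real.log_div ht'.ne' hv'.ne', Real.log_mul (by positivity) hv'.ne',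
      Real.log_mul (by positivity) ht'.ne']
    simp only [sub_zero]
    ring
  have hx : MemLp (fun z : ℝ × ℝ => z.1) 2 (p.prod (gaussianReal 0 v)) :=
    hp.comp_fst _
  have hz : MemLp (fun z : ℝ × ℝ => z.2) 2 (p.prod (gaussianReal 0 v)) :=
    (memLp_id_gaussianReal (μ := 0) (v := v) 2).comp_snd _
  have hx2 := hx.integrable_sq
  have hz2 := hz.integrable_sq
  have hxz : Integrable (fun z : ℝ × ℝ => z.1 * z.2) (p.prod (gaussianReal 0 v)) :=
    hx.integrable_mul hz
  have hFm : Measurable F := by fun_prop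
  have hcomp : F ∘ (fun z : ℝ × ℝ => (z.1, z.1 + z.2)) = fun z =>
      1 / 2 * Real.log (t / v) + ((1 / (2 * t) - 1 / (2 * v)) * z.2 ^ 2
        + (1 / (2 * t) * z.1 ^ 2 + 1 / t * (z.1 * z.2))) := by
    ext z
    simp only [hF, Function.comp]
    field_simp
    ring
  have hint : Integrable F (awgnLaw p v) := by
    rw [awgnLaw, integrable_map_measure hFm.aestronglyMeasurable (by fun_prop), hcomp]
    exact (integrable_const _).add ((hz2.const_mul _).add ((hx2.const_mul _).add (hxz.const_mul _)))
  have hval : ∫ z, F z ∂(awgnLaw p v)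
      = 1 / 2 * Real.log (t / v) - 1 / 2 + (∫ x, x ^ 2 ∂p + v) / (2 * t) := by
    rw [awgnLaw, integral_map (by fun_prop) hFm.aestronglyMeasurable]
    have e1 : ∫ z : ℝ × ℝ, z.1 ^ 2 ∂(p.prod (gaussianReal 0 v)) = ∫ x, x ^ 2 ∂p := by
      rw [integral_fun_fst (fun x : ℝ => x ^ 2)]; simp
    have e2 : ∫ z : ℝ × ℝ, z.2 ^ 2 ∂(p.prod (gaussianReal 0 v)) = v := by
      rw [integral_fun_snd (fun x : ℝ => x ^ 2), integral_sq_gaussianReal]; simp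
    have e3 : ∫ z : ℝ × ℝ, z.1 * z.2 ∂(p.prod (gaussianReal 0 v)) = 0 := by
      rw [integral_prod_mul (fun x : ℝ => x) (fun y : ℝ => y), integral_id_gaussianReal, mul_zero]
    have i1 := (hx2.const_mul (1 / (2 * t : ℝ))).fun_add (hxz.const_mul (1 / t : ℝ))
    have i2 := (hz2.const_mul (1 / (2 * t) - 1 / (2 * v) : ℝ)).fun_add i1
    calc _ = ∫ z, (F ∘ (fun z : ℝ × ℝ => (z.1, z.1 + z.2))) z ∂(p.prod (gaussianReal 0 v)) := rfl
      _ = _ := by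
        rw [hcomp]
        beta_reduce
        rw [integral_add (integrable_const _) i2, integral_add (hz2.const_mul _) i1,
          integral_add (hx2.const_mul _) (hxz.const_mul _), integral_const, integral_const_mul,
          integral_const_mul, integral_const_mul, e1, e2, e3]
        simp
        field_simp
        ring
  rw [klDiv_of_ac_of_integrable hac (hint.congr hllr.symm), integral_congr_ae hllr, hval]
  simp

lemma integral_sq_le_of_lintegral_sq_le {p : Measure ℝ} {P : ℝ≥0}
    (h : ∫⁻ s, ENNReal.ofReal (s ^ 2) ∂p ≤ P) : MemLp id 2 p ∧ ∫ x, x ^ 2 ∂p ≤ P := by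
  have hi : Integrable (fun x : ℝ => x ^ 2) p := by
    refine ⟨by fun_prop, ?_⟩
    rw [hasFiniteIntegral_iff_ofReal (ae_of_all _ fun x => sq_nonneg x)]
    exact h.trans_lt ENNReal.coe_lt_top
  refine ⟨(memLp_two_iff_integrable_sq (by fun_prop)).2 hi, ?_⟩
  rw [integral_eq_lintegral_of_nonneg_ae (ae_of_all _ fun x => sq_nonneg x) (by fun_prop)]
  exact ENNReal.toReal_le_of_le_ofReal P.2 (by simpa using h)

/-- Dropping the divergence term gives the capacity upper bound; for a Gaussian input and matching
`t` that term is zero, which gives attainment. -/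
lemma mutualInfoBits_awgnLaw_add (p : Measure ℝ) [IsProbabilityMeasure p] {v t : ℝ≥0}
    (hv : v ≠ 0) (ht : t ≠ 0) (hp : MemLp id 2 p) :
    klDiv (p ∗ gaussianReal 0 v) (gaussianReal 0 t) / ENNReal.ofReal (Real.log 2)
      + mutualInfoBits (awgnLaw p v) = ENNReal.ofReal
      ((1 / 2 * Real.log (t / v) - 1 / 2 + (∫ x, x ^ 2 ∂p + v) / (2 * t)) / Real.log 2) := by
  have h := klDiv_prod_eq_add (awgnLaw p v) (gaussianReal 0 t)
  have hf := awgnLaw_fst p v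
  have hs := awgnLaw_snd p v
  rw [hf, hs, klDiv_awgnLaw_prod_gaussianReal p hv ht hp] at h
  rw [mutualInfoBits, ENNReal.ofReal_div_of_pos (Real.log_pos one_lt_two), h, ENNReal.add_div]
  change _ + klDiv _ ((awgnLaw p v).fst.prod (awgnLaw p v).snd) / _ = _
  rw [hf, hs]

/-- Among inputs of power at most `P`, none has more than the Gaussian mutual information. -/
lemma mutualInfoBits_awgnLaw_le (p : Measure ℝ) [IsProbabilityMeasure p] {v P : ℝ≥0} (hv : v ≠ 0)
    (hp : ∫⁻ s, ENNReal.ofReal (s ^ 2) ∂p ≤ P) :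
    mutualInfoBits (awgnLaw p v) ≤ ENNReal.ofReal (1 / 2 * Real.logb 2 (1 + P / v)) := by
  obtain ⟨h1, h2⟩ := integral_sq_le_of_lintegral_sq_le hp
  have hv' : (0 : ℝ) < v := by positivity
  -- The reference variance is the largest output variance the power constraint allows, so that the
  -- non-logarithmic terms sum to at most zero.
  have ht : v + P ≠ 0 := by positivity
  refine (le_of_le_of_eq le_add_self (mutualInfoBits_awgnLaw_add p hv ht h1)).trans
    (ENNReal.ofReal_le_ofReal ?_)
  have hl := Real.log_pos one_lt_two
  rw [Real.logb, ← mul_div_assoc]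
  refine div_le_div_of_nonneg_right ?_ hl.le
  have e : ((v + P : ℝ≥0) : ℝ) / v = 1 + P / v := by push_cast; field_simp
  rw [e]
  have : (∫ x, x ^ 2 ∂p + v) / (2 * ((v + P : ℝ≥0) : ℝ)) ≤ 1 / 2 := by
    rw [div_le_iff₀ (by positivity)]
    push_cast
    linarith
  linarith

lemma mutualInfoBits_awgnLaw_gaussianReal {v P : ℝ≥0} (hv : v ≠ 0) :
    mutualInfoBits (awgnLaw (gaussianReal 0 P) v)
      = ENNReal.ofReal (1 / 2 * Real.logb 2 (1 + P / v)) := by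
  have ht : P + v ≠ 0 := by positivity
  have hv' : (0 : ℝ) < v := by positivity
  have h := mutualInfoBits_awgnLaw_add (gaussianReal 0 P) hv ht (memLp_id_gaussianReal 2)
  rw [gaussianReal_conv_gaussianReal, zero_add, klDiv_self, ENNReal.zero_div, zero_add,
    integral_sq_gaussianReal] at h
  rw [h, Real.logb]
  congr 1
  have e : ((P + v : ℝ≥0) : ℝ) / v = 1 + P / v := by push_cast; field_simp; ring
  rw [e]
  push_cast
  have : (P : ℝ) + v ≠ 0 := by positivity
  field_simp
  ring

lemma lintegral_sq_gaussianReal (P : ℝ≥0) :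
    ∫⁻ s, ENNReal.ofReal (s ^ 2) ∂(gaussianReal 0 P) = P := by
  rw [← ofReal_integral_eq_lintegral_ofReal
    (by simpa using (memLp_id_gaussianReal (μ := 0) (v := P) 2).integrable_sq)
    (ae_of_all _ fun x => sq_nonneg x), integral_sq_gaussianReal, ENNReal.ofReal_coe_nnreal]

/-! ### The source-relay channel -/

/-- Variance of the noise plus the residual self-interference when the relay sends `x`. -/
noncomputable def relayNoiseVar (α σR2 : ℝ≥0) (x : ℝ) : ℝ≥0 := NNReal.mk (x ^ 2) (sq_nonneg x) * α + σR2

lemma coe_relayNoiseVar (α σR2 : ℝ≥0) (x : ℝ) :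
    (relayNoiseVar α σR2 x : ℝ) = α * x ^ 2 + σR2 := by
  rw [relayNoiseVar, NNReal.coe_add, NNReal.coe_mul, mul_comm]
  rfl

lemma relayNoiseVar_ne_zero (α : ℝ≥0) {σR2 : ℝ≥0} (h : 0 < σR2) (x : ℝ) :
    relayNoiseVar α σR2 x ≠ 0 :=
  (h.trans_le le_add_self).ne'

/-- For fixed `x`, scaled gain plus noise is a sum of independent centred Gaussians, so everything
proved for additive Gaussian noise applies. -/
lemma sourceRelayLaw_eq_awgnLaw (α σR2 : ℝ≥0) (x : ℝ) (p : Measure ℝ) [IsProbabilityMeasure p] :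
    sourceRelayLaw α σR2 x p = awgnLaw p (relayNoiseVar α σR2 x) := by
  have h : ((gaussianReal 0 α).prod (gaussianReal 0 σR2)).map (fun t => t.1 * x + t.2)
      = gaussianReal 0 (relayNoiseVar α σR2 x) := by
    have h1 := gaussianReal_conv_gaussianReal (m₁ := 0) (m₂ := 0)
      (v₁ := NNReal.mk (x ^ 2) (sq_nonneg x) * α) (v₂ := σR2)
    have h2 := gaussianReal_map_mul_const (μ := 0) (v := α) x
    rw [mul_zero] at h2
    rw [← h2, zero_add, Measure.conv] at h1
    rw [← Measure.map_id (μ := gaussianReal 0 σR2)] at h1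
    rw [Measure.map_prod_map _ _ (by fun_prop) (by fun_prop),
      Measure.map_map (by fun_prop) (by fun_prop)] at h1
    exact h1
  rw [awgnLaw, ← h]
  nth_rw 2 [← Measure.map_id (μ := p)]
  rw [Measure.map_prod_map _ _ (by fun_prop) (by fun_prop),
    Measure.map_map (by fun_prop) (by fun_prop), sourceRelayLaw]
  congr 1
  ext t
  · rfl
  · simp [add_assoc]

lemma sourceRelayInfoAt_le {α σR2 : ℝ≥0} (hσR : 0 < σR2) (x : ℝ) (p : Measure ℝ)
    [IsProbabilityMeasure p] {P : ℝ≥0} (hp : ∫⁻ s, ENNReal.ofReal (s ^ 2) ∂p ≤ P) :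
    sourceRelayInfoAt α σR2 x p
      ≤ ENNReal.ofReal (1 / 2 * Real.logb 2 (1 + P / (α * x ^ 2 + σR2))) := by
  rw [sourceRelayInfoAt, sourceRelayLaw_eq_awgnLaw, ← coe_relayNoiseVar]
  exact mutualInfoBits_awgnLaw_le p (relayNoiseVar_ne_zero α hσR x) hp

lemma sourcePower_zero (α : ℝ≥0) (xth : ℝ) : sourcePower α xth 0 = α * xth ^ 2 := by
  simp [sourcePower, max_eq_right (sq_nonneg xth)]

lemma sourcePower_nonneg (α : ℝ≥0) (xth x : ℝ) : 0 ≤ sourcePower α xth x :=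
  mul_nonneg α.2 (le_max_left _ _)

lemma isGreatest_sourceRelayInfoAt_zero (α : ℝ≥0) {σR2 : ℝ≥0} (hσR : 0 < σR2) (xth : ℝ) :
    IsGreatest
      {I : ℝ≥0∞ | ∃ p : Measure ℝ, IsProbabilityMeasure p ∧
        ∫⁻ s, ENNReal.ofReal (s ^ 2) ∂p ≤ ENNReal.ofReal (sourcePower α xth 0) ∧
        I = sourceRelayInfoAt α σR2 0 p}
      (ENNReal.ofReal (1 / 2 * Real.logb 2 (1 + α * xth ^ 2 / σR2))) := by
  have hP : ((sourcePower α xth 0).toNNReal : ℝ) = α * xth ^ 2 := by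
    rw [Real.coe_toNNReal _ (sourcePower_nonneg α xth 0), sourcePower_zero]
  refine ⟨⟨gaussianReal 0 (sourcePower α xth 0).toNNReal, inferInstance, ?_, ?_⟩, ?_⟩
  · exact (lintegral_sq_gaussianReal _).le
  · rw [sourceRelayInfoAt, sourceRelayLaw_eq_awgnLaw,
      mutualInfoBits_awgnLaw_gaussianReal (relayNoiseVar_ne_zero α hσR 0), coe_relayNoiseVar, hP]
    simp
  · rintro _ ⟨p, hp, hpow, rfl⟩
    refine (sourceRelayInfoAt_le hσR 0 p (P := (sourcePower α xth 0).toNNReal) hpow).trans_eq ?_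
    rw [hP]
    simp

/-! ### The capacity -/

lemma relayDestInfo_le (ν : Measure ℝ) [IsProbabilityMeasure ν] {σD2 P : ℝ≥0} (hσD : 0 < σD2)
    (hν : ∫⁻ x, ENNReal.ofReal (x ^ 2) ∂ν ≤ P) :
    relayDestInfo σD2 ν ≤ ENNReal.ofReal (1 / 2 * Real.logb 2 (1 + P / σD2)) :=
  mutualInfoBits_awgnLaw_le ν hσD.ne' hν

lemma relayCapacity_ne_top (α σR2 PS PR : ℝ≥0) {σD2 : ℝ≥0} (hσD : 0 < σD2) :
    relayCapacity α σR2 σD2 PS PR ≠ ∞ := by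
  refine ne_top_of_le_ne_top
    (ENNReal.ofReal_ne_top (r := 1 / 2 * Real.logb 2 (1 + PR / σD2))) ?_
  exact iSup_le fun ν => iSup_le fun _ => iSup_le fun hν =>
    (min_le_right _ _).trans (relayDestInfo_le ν hσD hν)

/-- Tangent bound for `q ↦ log (1 + q / w)`, at `q₀`, with slope `1 / l` at least the slope of the
tangent wherever `q` is below `q₀`. -/
lemma log_one_add_div_le {w q q₀ l : ℝ} (hw : 0 < w) (hq : 0 ≤ q) (hq₀ : 0 ≤ q₀)
    (h : l = w + q₀ ∨ q₀ = 0 ∧ 0 < l ∧ l ≤ w) :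
    Real.log (1 + q / w) ≤ Real.log (1 + q₀ / w) + (q - q₀) / l := by
  have e : ∀ r, 0 ≤ r → 1 + r / w = (w + r) / w := fun r _ => by field_simp
  have h1 : Real.log (1 + q / w) - Real.log (1 + q₀ / w) ≤ (q - q₀) / (w + q₀) := by
    rw [e q hq, e q₀ hq₀, ← Real.log_div (by positivity) (by positivity)]
    refine (Real.log_le_sub_one_of_pos (by positivity)).trans_eq ?_
    field_simp
    ring
  rcases h with rfl | ⟨rfl, hl, hlw⟩
  · linarith
  · have : q / w ≤ q / l := div_le_div_of_nonneg_left hq hl hlw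
    simp only [sub_zero, add_zero] at *
    linarith

/-- The Lagrangian inequality of water-filling, with multiplier determined by the water level `α
xth² + σR2`. Each side carries a power term instead of their difference, so that it transfers to
`ℝ≥0∞`. -/
lemma waterfilling_tangent {α σR2 : ℝ≥0} (hσR : 0 < σR2) (xth x : ℝ) {q : ℝ} (hq : 0 ≤ q) :
    1 / 2 * Real.logb 2 (1 + q / (α * x ^ 2 + σR2))
        + 1 / (2 * (α * xth ^ 2 + σR2) * Real.log 2) * sourcePower α xth x
      ≤ {x : ℝ | |x| < |xth|}.indicator (fun _ => 1 / 2 * Real.logb 2 (1 + α * xth ^ 2 / σR2)) x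
        + 1 / (2 * (α * xth ^ 2 + σR2) * Real.log 2) * q := by
  have hσ : (0 : ℝ) < σR2 := hσR
  have hα : (0 : ℝ) ≤ α := α.2
  have hw : (0 : ℝ) < α * x ^ 2 + σR2 := by positivity
  have hl : (0 : ℝ) < α * xth ^ 2 + σR2 := by positivity
  have hlog := Real.log_pos one_lt_two
  have key : Real.log (1 + q / (α * x ^ 2 + σR2))
      ≤ Real.log (1 + sourcePower α xth x / (α * x ^ 2 + σR2))
        + (q - sourcePower α xth x) / (α * xth ^ 2 + σR2) := by
    refine log_one_add_div_le hw hq (sourcePower_nonneg _ _ _) ?_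
    by_cases h : |x| < |xth|
    · left
      rw [sourcePower, max_eq_right (by linarith [sq_lt_sq.2 h])]
      ring
    · right
      have h' := sq_le_sq.2 (not_lt.1 h)
      refine ⟨by rw [sourcePower, max_eq_left (by linarith), mul_zero], hl, ?_⟩
      gcongr
  -- The rate at `x` is replaced by the rate at `0`, which has the larger power and the smaller
  -- noise; where the source is silent both sides vanish.
  have key2 : 1 / 2 * Real.logb 2 (1 + sourcePower α xth x / (α * x ^ 2 + σR2))
      ≤ {x : ℝ | |x| < |xth|}.indicator
        (fun _ => 1 / 2 * Real.logb 2 (1 + α * xth ^ 2 / σR2)) x := by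
    by_cases h : |x| < |xth|
    · rw [Set.indicator_of_mem (by exact h)]
      have hle : sourcePower α xth x ≤ α * xth ^ 2 := by
        rw [sourcePower, max_eq_right (by linarith [sq_lt_sq.2 h])]
        nlinarith [mul_nonneg hα (sq_nonneg x)]
      have := sourcePower_nonneg α xth x
      have hd : sourcePower α xth x / (α * x ^ 2 + σR2) ≤ α * xth ^ 2 / σR2 :=
        div_le_div₀ (by positivity) hle hσ (by nlinarith [mul_nonneg hα (sq_nonneg x)])
      have : (0 : ℝ) < 1 + sourcePower α xth x / (α * x ^ 2 + σR2) := by positivity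
      gcongr
      norm_num
    · rw [Set.indicator_of_notMem (by exact h), sourcePower,
        max_eq_left (by linarith [sq_le_sq.2 (not_lt.1 h)])]
      simp
  have e : 1 / 2 * Real.logb 2 (1 + q / (α * x ^ 2 + σR2))
      ≤ 1 / 2 * Real.logb 2 (1 + sourcePower α xth x / (α * x ^ 2 + σR2))
        + 1 / (2 * (α * xth ^ 2 + σR2) * Real.log 2) * (q - sourcePower α xth x) := by
    rw [Real.logb, Real.logb]
    calc _ ≤ 1 / 2 * ((Real.log (1 + sourcePower α xth x / (α * x ^ 2 + σR2))
        + (q - sourcePower α xth x) / (α * xth ^ 2 + σR2)) / Real.log 2) := by gcongr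
      _ = _ := by field_simp
  linarith

lemma sourceRelayRate_le {α σR2 PS : ℝ≥0} (hσR : 0 < σR2) (ν : Measure ℝ) [IsProbabilityMeasure ν]
    {xth : ℝ} (hxth : 0 < xth) (hpow : ∫ x, sourcePower α xth x ∂ν = PS) :
    sourceRelayRate α σR2 PS ν
      ≤ ENNReal.ofReal (1 / 2 * Real.logb 2 (1 + α * xth ^ 2 / σR2) * transmitProb ν xth) := by
  refine iSup_le fun κ => iSup_le fun _ => iSup_le fun hκ => ?_
  have hσ : (0 : ℝ) < σR2 := hσR
  set c : ℝ := 1 / (2 * (α * xth ^ 2 + σR2) * Real.log 2) with hc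
  set B : ℝ := 1 / 2 * Real.logb 2 (1 + α * xth ^ 2 / σR2) with hB
  have hc0 : 0 < c := by
    have := Real.log_pos one_lt_two
    positivity
  have hB0 : 0 ≤ B := by
    have : (0 : ℝ) ≤ α * xth ^ 2 / σR2 := by positivity
    exact mul_nonneg (by norm_num) (Real.logb_nonneg one_lt_two (by linarith))
  have hspm : Measurable fun x => sourcePower α xth x := by unfold sourcePower; fun_prop
  have hpt : ∀ x, sourceRelayInfoAt α σR2 x (κ x) + ENNReal.ofReal (c * sourcePower α xth x)
      ≤ {x : ℝ | |x| < xth}.indicator (fun _ => ENNReal.ofReal B) x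
        + ENNReal.ofReal c * ∫⁻ s, ENNReal.ofReal (s ^ 2) ∂(κ x) := by
    intro x
    -- The power constraint holds only on average, so `κ x` may have infinite power for some `x`;
    -- the right side is then infinite because `c > 0`.
    rcases eq_or_ne (∫⁻ s, ENNReal.ofReal (s ^ 2) ∂(κ x)) ∞ with htop | htop
    · rw [htop, ENNReal.mul_top (by simpa using hc0)]
      simp
    · lift ∫⁻ s, ENNReal.ofReal (s ^ 2) ∂(κ x) to ℝ≥0 using htop with q hq
      have h1 := sourceRelayInfoAt_le (α := α) hσR x (κ x) hq.symm.le
      have h2 := waterfilling_tangent (α := α) hσR xth x q.2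
      rw [abs_of_pos hxth, ← hc, ← hB] at h2
      have hα : (0 : ℝ) ≤ α := α.2
      have h0 : 0 ≤ 1 / 2 * Real.logb 2 (1 + q / (α * x ^ 2 + σR2)) :=
        mul_nonneg (by norm_num) (Real.logb_nonneg one_lt_two
          (by have : (0 : ℝ) ≤ q / (α * x ^ 2 + σR2) := by positivity
              linarith))
      have h3 : {x : ℝ | |x| < xth}.indicator (fun _ => ENNReal.ofReal B) x
          = ENNReal.ofReal ({x : ℝ | |x| < xth}.indicator (fun _ => B) x) := by
        by_cases h : |x| < xth <;> simp [Set.indicator, h]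
      have h4 : 0 ≤ {x : ℝ | |x| < xth}.indicator (fun _ => B) x :=
        Set.indicator_nonneg (fun _ _ => hB0) x
      calc _ ≤ ENNReal.ofReal (1 / 2 * Real.logb 2 (1 + q / (α * x ^ 2 + σR2)))
            + ENNReal.ofReal (c * sourcePower α xth x) := by gcongr
        _ ≤ ENNReal.ofReal ({x : ℝ | |x| < xth}.indicator (fun _ => B) x + c * q) := by
          rw [← ENNReal.ofReal_add h0 (mul_nonneg hc0.le (sourcePower_nonneg _ _ _))]
          exact ENNReal.ofReal_le_ofReal h2
        _ = _ := by
          rw [ENNReal.ofReal_add h4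
            (mul_nonneg hc0.le (NNReal.coe_nonneg q)), h3, ENNReal.ofReal_mul hc0.le, ENNReal.ofReal_coe_nnreal]
  have hint : Integrable (fun x => sourcePower α xth x) ν := by
    refine Integrable.of_bound hspm.aestronglyMeasurable (α * xth ^ 2) (ae_of_all _ fun x => ?_)
    rw [Real.norm_of_nonneg (sourcePower_nonneg _ _ _), sourcePower]
    exact mul_le_mul_of_nonneg_left (max_le (sq_nonneg _) (by linarith [sq_nonneg x])) α.2
  have hset : MeasurableSet {x : ℝ | |x| < xth} := measurableSet_lt (by fun_prop) (by fun_prop)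
  have hpS : ∫⁻ x, ENNReal.ofReal (c * sourcePower α xth x) ∂ν = ENNReal.ofReal c * PS := by
    rw [← ofReal_integral_eq_lintegral_ofReal (hint.const_mul c)
      (ae_of_all _ fun x => mul_nonneg hc0.le (sourcePower_nonneg _ _ _)), integral_const_mul,
      hpow, ENNReal.ofReal_mul hc0.le, ENNReal.ofReal_coe_nnreal]
  have hmono := lintegral_mono (μ := ν) hpt
  -- Only the power term has to be measurable here, so no measurability of the information in `x` is
  -- needed.
  rw [lintegral_add_right _ (by fun_prop), hpS,
    lintegral_add_left (measurable_const.indicator hset), lintegral_indicator_const hset,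
    lintegral_const_mul _ (Measurable.lintegral_kernel (by fun_prop))] at hmono
  have hfin : ENNReal.ofReal c * (PS : ℝ≥0∞) ≠ ∞ :=
    ENNReal.mul_ne_top ENNReal.ofReal_ne_top ENNReal.coe_ne_top
  have hle : ∫⁻ x, sourceRelayInfoAt α σR2 x (κ x) ∂ν + ENNReal.ofReal c * PS
      ≤ ENNReal.ofReal B * ν {x | |x| < xth} + ENNReal.ofReal c * PS :=
    hmono.trans (by gcongr)
  rw [transmitProb, ENNReal.ofReal_mul hB0, ofReal_measureReal]
  exact (ENNReal.add_le_add_iff_right hfin).1 hle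

/-- Otherwise the allocated power would vanish almost everywhere and could not average to `PS > 0`.
Positivity makes the block length tend to infinity. -/
lemma transmitProb_pos {α PS : ℝ≥0} (hPS : 0 < PS) (ν : Measure ℝ) [IsProbabilityMeasure ν]
    {xth : ℝ} (hxth : 0 < xth) (hpow : ∫ x, sourcePower α xth x ∂ν = PS) :
    0 < transmitProb ν xth := by
  refine measureReal_nonneg.lt_of_ne fun h => ?_
  have h0 : ν {x | |x| < xth} = 0 := (measureReal_eq_zero_iff).1 h.symm
  have : ∫ x, sourcePower α xth x ∂ν = 0 := by
    refine integral_eq_zero_of_ae ?_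
    filter_upwards [measure_eq_zero_iff_ae_notMem.1 h0] with x hx
    have hx' : xth ^ 2 ≤ x ^ 2 := by
      rw [← sq_abs x]
      exact pow_le_pow_left₀ hxth.le (not_lt.1 hx) 2
    simp [sourcePower, max_eq_left (sub_nonpos.2 hx')]
  rw [this] at hpow
  exact hPS.ne (NNReal.coe_injective (by simpa using hpow))

lemma toReal_relayCapacity_le {α σR2 σD2 PS PR : ℝ≥0} (hσR : 0 < σR2)
    (ν : Measure ℝ) [IsProbabilityMeasure ν] (hν : IsOptimalRelayInput α σR2 σD2 PS PR ν)
    {xth : ℝ} (hxth : 0 < xth) (hpow : ∫ x, sourcePower α xth x ∂ν = PS) :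
    (relayCapacity α σR2 σD2 PS PR).toReal
      ≤ 1 / 2 * Real.logb 2 (1 + α * xth ^ 2 / σR2) * transmitProb ν xth := by
  refine ENNReal.toReal_le_of_le_ofReal ?_ ?_
  · have hσ : (0 : ℝ) < σR2 := hσR
    have : (0 : ℝ) ≤ α * xth ^ 2 / σR2 := by positivity
    exact mul_nonneg (mul_nonneg (by norm_num)
      (Real.logb_nonneg one_lt_two (by linarith))) measureReal_nonneg
  · rw [← hν.2]
    exact (min_le_left _ _).trans (sourceRelayRate_le hσR ν hxth hpow)

/-! ### The Gaussian joint density -/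

/-- Joint density of `X ∼ N(0, 1)` and `Y = s X + Z` with independent `Z ∼ N(0, v)`. -/
noncomputable def awgnDensity (s : ℝ) (v : ℝ≥0) (x y : ℝ) : ℝ :=
  gaussianPDFReal 0 1 x * gaussianPDFReal (s * x) v y

/-- Variance of the output `s X + Z`. -/
noncomputable def awgnOutVar (s : ℝ) (v : ℝ≥0) : ℝ≥0 := NNReal.mk (s ^ 2) (sq_nonneg s) + v

lemma coe_awgnOutVar (s : ℝ) (v : ℝ≥0) : (awgnOutVar s v : ℝ) = s ^ 2 + v := by
  rw [awgnOutVar, NNReal.coe_add]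
  rfl

lemma awgnOutVar_ne_zero (s : ℝ) {v : ℝ≥0} (hv : v ≠ 0) : awgnOutVar s v ≠ 0 :=
  ((pos_iff_ne_zero.2 hv).trans_le le_add_self).ne'

lemma awgnDensity_pos (s : ℝ) {v : ℝ≥0} (hv : v ≠ 0) (x y : ℝ) : 0 < awgnDensity s v x y :=
  mul_pos (gaussianPDFReal_pos _ _ _ one_ne_zero) (gaussianPDFReal_pos _ _ _ hv)

lemma measurable_awgnDensity (s : ℝ) (v : ℝ≥0) :
    Measurable fun z : ℝ × ℝ => awgnDensity s v z.1 z.2 := by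
  unfold awgnDensity gaussianPDFReal
  fun_prop

/-- Bayes' formula, by completing the square: the output density times the Gaussian posterior of the
input. It yields the output marginal and the unit mean of the likelihood ratio. -/
lemma awgnDensity_eq (s : ℝ) {v : ℝ≥0} (hv : v ≠ 0) (x y : ℝ) :
    awgnDensity s v x y = gaussianPDFReal 0 (awgnOutVar s v) y
      * gaussianPDFReal (s * y / awgnOutVar s v) (v / awgnOutVar s v) x := by
  have hv' : (0 : ℝ) < v := by positivity
  have hT : (0 : ℝ) < s ^ 2 + v := by positivity
  simp only [awgnDensity, gaussianPDFReal, NNReal.coe_div, coe_awgnOutVar, NNReal.coe_one]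
  rw [mul_mul_mul_comm, mul_mul_mul_comm (√(2 * Real.pi * (s ^ 2 + v)))⁻¹, ← Real.exp_add,
    ← Real.exp_add, ← mul_inv, ← mul_inv, ← Real.sqrt_mul (by positivity),
    ← Real.sqrt_mul (by positivity)]
  refine congrArg₂ (· * ·) (congrArg (fun t => (√t)⁻¹) ?_) (congrArg Real.exp ?_)
  · field_simp
  · field_simp
    ring

lemma margFst_awgnDensity (s : ℝ) {v : ℝ≥0} (hv : v ≠ 0) :
    margFst (awgnDensity s v) = gaussianPDFReal 0 1 := by
  ext x
  simp only [margFst, awgnDensity]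
  rw [integral_const_mul, integral_gaussianPDFReal_eq_one _ hv, mul_one]

lemma margSnd_awgnDensity (s : ℝ) {v : ℝ≥0} (hv : v ≠ 0) :
    margSnd (awgnDensity s v) = gaussianPDFReal 0 (awgnOutVar s v) := by
  ext y
  simp only [margSnd, awgnDensity_eq s hv]
  rw [integral_const_mul, integral_gaussianPDFReal_eq_one _
    (div_ne_zero hv (awgnOutVar_ne_zero s hv)), mul_one]

/-- Law of the pair of a codeword symbol and a noise symbol. -/
noncomputable def symbolNoiseLaw (v : ℝ≥0) : Measure (ℝ × ℝ) :=
  (gaussianReal 0 1).prod (gaussianReal 0 v)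

instance (v : ℝ≥0) : IsProbabilityMeasure (symbolNoiseLaw v) := by
  unfold symbolNoiseLaw; infer_instance

lemma map_symbolNoiseLaw (s : ℝ) {v : ℝ≥0} (hv : v ≠ 0) :
    (symbolNoiseLaw v).map (fun z => (z.1, s * z.1 + z.2))
      = volume.withDensity (fun z => ENNReal.ofReal (awgnDensity s v z.1 z.2)) := by
  have hm := (measurable_awgnDensity s v).ennreal_ofReal
  refine Measure.ext_of_lintegral _ fun g hg => ?_
  have e2 : ∫⁻ z, g z ∂(volume.withDensity (fun z => ENNReal.ofReal (awgnDensity s v z.1 z.2))) =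
      ∫⁻ x, ∫⁻ y, ENNReal.ofReal (awgnDensity s v x y) * g (x, y) := by
    rw [lintegral_withDensity_eq_lintegral_mul _ hm hg, Measure.volume_eq_prod,
      lintegral_prod _ (hm.mul hg).aemeasurable]
    rfl
  have e1 : ∫⁻ z, g z ∂((symbolNoiseLaw v).map (fun z => (z.1, s * z.1 + z.2)))
      = ∫⁻ x, ∫⁻ y, g (x, y) ∂(gaussianReal (s * x) v) ∂(gaussianReal 0 1) := by
    rw [symbolNoiseLaw, lintegral_map hg (by fun_prop), lintegral_prod _ (by fun_prop)]
    refine lintegral_congr fun x => ?_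
    have := gaussianReal_map_const_add (μ := 0) (v := v) (s * x)
    rw [zero_add] at this
    rw [← this, lintegral_map (by fun_prop) (by fun_prop)]
  have e3 : ∀ x, ∫⁻ y, g (x, y) ∂(gaussianReal (s * x) v)
      = ∫⁻ y, gaussianPDF (s * x) v y * g (x, y) := fun x => by
    have m1 : Measurable fun y => g (x, y) := by fun_prop
    rw [gaussianReal_of_var_ne_zero _ hv,
      lintegral_withDensity_eq_lintegral_mul _ (measurable_gaussianPDF _ _) m1]
    rfl
  have m2 : Measurable fun x => ∫⁻ y, gaussianPDF (s * x) v y * g (x, y) := by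
    refine Measurable.lintegral_prod_right' (f := fun z : ℝ × ℝ => gaussianPDF (s * z.1) v z.2 * g z)
      (Measurable.mul ?_ hg)
    unfold gaussianPDF gaussianPDFReal
    fun_prop
  simp_rw [e1, e2, e3]
  rw [gaussianReal_of_var_ne_zero _ one_ne_zero,
    lintegral_withDensity_eq_lintegral_mul _ (measurable_gaussianPDF _ _) m2]
  refine lintegral_congr fun x => ?_
  have m3 : Measurable fun y => gaussianPDF (s * x) v y * g (x, y) :=
    (measurable_gaussianPDF _ _).mul (by fun_prop)
  rw [Pi.mul_apply, ← lintegral_const_mul _ m3]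
  refine lintegral_congr fun y => ?_
  rw [← mul_assoc, gaussianPDF, gaussianPDF, awgnDensity,
    ENNReal.ofReal_mul (gaussianPDFReal_nonneg _ _ _)]

lemma logb_gaussianPDFReal (m : ℝ) {v : ℝ≥0} (hv : v ≠ 0) (x : ℝ) :
    Real.logb 2 (gaussianPDFReal m v x)
      = -(1 / 2 * Real.logb 2 (2 * Real.pi * v)) - (x - m) ^ 2 / (2 * v * Real.log 2) := by
  rw [Real.logb, log_gaussianPDFReal m hv, Real.logb, sub_div, neg_div, mul_div_assoc, div_div]

lemma diffEntropyBits_gaussianPDFReal {v : ℝ≥0} (hv : v ≠ 0) :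
    diffEntropyBits (gaussianPDFReal 0 v)
      = 1 / 2 * Real.logb 2 (2 * Real.pi * v) + 1 / (2 * Real.log 2) := by
  have hv' : (0 : ℝ) < v := by positivity
  have h := integral_gaussianReal_eq_integral_smul (μ := 0) hv
    (f := fun x => Real.logb 2 (gaussianPDFReal 0 v x))
  simp only [smul_eq_mul] at h
  rw [diffEntropyBits, ← h]
  simp only [logb_gaussianPDFReal 0 hv, sub_zero]
  have hi : Integrable (fun x : ℝ => x ^ 2) (gaussianReal 0 v) :=
    (memLp_id_gaussianReal (μ := 0) (v := v) 2).integrable_sq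
  rw [integral_sub (integrable_const _) (hi.div_const _), integral_const, integral_div,
    integral_sq_gaussianReal]
  simp
  field_simp
  ring

/-! ### Quadratic functions of a codeword symbol and a noise symbol -/

section Quadratic

variable (v : ℝ≥0)

lemma memLp_symbolNoiseLaw :
    MemLp (fun z : ℝ × ℝ => z.1 ^ 2) 2 (symbolNoiseLaw v) ∧
    MemLp (fun z : ℝ × ℝ => z.2 ^ 2) 2 (symbolNoiseLaw v) ∧
    MemLp (fun z : ℝ × ℝ => z.1 * z.2) 2 (symbolNoiseLaw v) := by
  have h4 : ∀ w, Integrable (fun x : ℝ => (x ^ 2) ^ 2) (gaussianReal 0 w) := fun w => by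
    have := (memLp_id_gaussianReal (μ := 0) (v := w) 4).integrable_norm_pow (by norm_num)
    refine this.congr (ae_of_all _ fun x => ?_)
    simp only [id, Real.norm_eq_abs]
    rw [← pow_mul]
    exact Even.pow_abs (by decide) x
  have h2 : ∀ w, Integrable (fun x : ℝ => x ^ 2) (gaussianReal 0 w) := fun w =>
    (memLp_id_gaussianReal (μ := 0) (v := w) 2).integrable_sq
  refine ⟨?_, ?_, ?_⟩
  · exact (memLp_two_iff_integrable_sq (by fun_prop)).2 ((h4 1).comp_fst _)
  · exact (memLp_two_iff_integrable_sq (by fun_prop)).2 ((h4 v).comp_snd _)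
  · refine (memLp_two_iff_integrable_sq (by fun_prop)).2 ?_
    simp only [mul_pow]
    exact (h2 1).mul_prod (h2 v)

/-- All three log densities have this form in symbol and noise, so finite fourth moments supply the
variances that Chebyshev's inequality needs. -/
lemma memLp_quadratic (a b c d : ℝ) :
    MemLp (fun z : ℝ × ℝ => a + (b * z.1 ^ 2 + (c * z.2 ^ 2 + d * (z.1 * z.2)))) 2
      (symbolNoiseLaw v) := by
  obtain ⟨h1, h2, h3⟩ := memLp_symbolNoiseLaw v
  exact (memLp_const a).add ((h1.const_mul b).add ((h2.const_mul c).add (h3.const_mul d)))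

lemma integral_quadratic (a b c d : ℝ) :
    ∫ z, (a + (b * z.1 ^ 2 + (c * z.2 ^ 2 + d * (z.1 * z.2)))) ∂(symbolNoiseLaw v)
      = a + b + c * v := by
  obtain ⟨h1, h2, h3⟩ := memLp_symbolNoiseLaw v
  have i1 := (h1.integrable one_le_two).const_mul b
  have i2 := (h2.integrable one_le_two).const_mul c
  have i3 := (h3.integrable one_le_two).const_mul d
  have e1 : ∫ z : ℝ × ℝ, z.1 ^ 2 ∂(symbolNoiseLaw v) = 1 := by
    rw [symbolNoiseLaw, integral_fun_fst (fun x : ℝ => x ^ 2), integral_sq_gaussianReal]; simp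
  have e2 : ∫ z : ℝ × ℝ, z.2 ^ 2 ∂(symbolNoiseLaw v) = v := by
    rw [symbolNoiseLaw, integral_fun_snd (fun x : ℝ => x ^ 2), integral_sq_gaussianReal]; simp
  have e3 : ∫ z : ℝ × ℝ, z.1 * z.2 ∂(symbolNoiseLaw v) = 0 := by
    rw [symbolNoiseLaw, integral_prod_mul (fun x : ℝ => x) (fun y : ℝ => y),
      integral_id_gaussianReal, zero_mul]
  rw [integral_add (integrable_const _) (i1.fun_add (i2.fun_add i3)),
    integral_add i1 (i2.fun_add i3), integral_add i2 i3, integral_const_mul, integral_const_mul,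
    integral_const_mul, e1, e2, e3]
  simp
  ring

end Quadratic

lemma neg_logb_awgnDensity (s : ℝ) {v : ℝ≥0} (hv : v ≠ 0) (x y : ℝ) :
    -Real.logb 2 (awgnDensity s v x y) = 1 / 2 * Real.logb 2 (2 * Real.pi)
      + 1 / 2 * Real.logb 2 (2 * Real.pi * v) + x ^ 2 / (2 * Real.log 2)
      + (y - s * x) ^ 2 / (2 * v * Real.log 2) := by
  rw [awgnDensity, Real.logb_mul (gaussianPDFReal_pos _ _ _ one_ne_zero).ne'
    (gaussianPDFReal_pos _ _ _ hv).ne', logb_gaussianPDFReal _ one_ne_zero,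
    logb_gaussianPDFReal _ hv]
  simp
  ring

lemma diffEntropyBits_awgnDensity (s : ℝ) {v : ℝ≥0} (hv : v ≠ 0) :
    diffEntropyBits (fun z : ℝ × ℝ => awgnDensity s v z.1 z.2)
      = 1 / 2 * Real.logb 2 (2 * Real.pi) + 1 / 2 * Real.logb 2 (2 * Real.pi * v)
        + 1 / Real.log 2 := by
  have hv' : (0 : ℝ) < v := by positivity
  have hm := measurable_awgnDensity s v
  have h1 : ∫ z, -Real.logb 2 (awgnDensity s v z.1 z.2)
      ∂((symbolNoiseLaw v).map (fun z => (z.1, s * z.1 + z.2)))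
      = diffEntropyBits (fun z : ℝ × ℝ => awgnDensity s v z.1 z.2) := by
    rw [map_symbolNoiseLaw s hv, integral_withDensity_eq_integral_toReal_smul hm.ennreal_ofReal
      (ae_of_all _ fun _ => ENNReal.ofReal_lt_top), diffEntropyBits, ← integral_neg]
    refine integral_congr_ae (ae_of_all _ fun z => ?_)
    simp only [smul_eq_mul, ENNReal.toReal_ofReal (awgnDensity_pos s hv z.1 z.2).le, mul_neg]
  have hml : Measurable fun z : ℝ × ℝ => -Real.logb 2 (awgnDensity s v z.1 z.2) := by
    unfold Real.logb
    fun_prop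
  rw [← h1, integral_map (by fun_prop) hml.aestronglyMeasurable]
  simp only [neg_logb_awgnDensity s hv]
  have h2 := integral_quadratic v (1 / 2 * Real.logb 2 (2 * Real.pi)
      + 1 / 2 * Real.logb 2 (2 * Real.pi * v)) (1 / (2 * Real.log 2)) (1 / (2 * v * Real.log 2)) 0
  calc _ = _ := integral_congr_ae (ae_of_all _ fun z => by ring)
    _ = _ := h2
    _ = _ := by field_simp; ring

/-- The rate `h(X) + h(Y) - h(X, Y)` of the Gaussian channel. -/
lemma diffEntropyBits_add_sub (s : ℝ) {v : ℝ≥0} (hv : v ≠ 0) :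
    diffEntropyBits (gaussianPDFReal 0 1) + diffEntropyBits (gaussianPDFReal 0 (awgnOutVar s v))
      - diffEntropyBits (fun z : ℝ × ℝ => awgnDensity s v z.1 z.2)
      = 1 / 2 * Real.logb 2 (1 + s ^ 2 / v) := by
  have hv' : (0 : ℝ) < v := by positivity
  have hT : (0 : ℝ) < s ^ 2 + v := by positivity
  rw [diffEntropyBits_gaussianPDFReal one_ne_zero,
    diffEntropyBits_gaussianPDFReal (awgnOutVar_ne_zero s hv), diffEntropyBits_awgnDensity s hv,
    coe_awgnOutVar]
  have e : 1 + s ^ 2 / v = (s ^ 2 + v) / v := by field_simp; ring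
  rw [e, Real.logb_div hT.ne' hv'.ne', Real.logb_mul (by positivity) hT.ne',
    Real.logb_mul (by positivity) hv'.ne']
  simp
  ring

/-! ### Joint typicality -/

lemma neg_inv_mul_logb_prod {n : ℕ} (g : Fin n → ℝ) (hg : ∀ i, g i ≠ 0) :
    -(1 / (n : ℝ)) * Real.logb 2 (∏ i, g i) = 1 / (n : ℝ) * ∑ i, -Real.logb 2 (g i) := by
  rw [Real.logb_prod _ _ fun i _ => hg i, Finset.sum_neg_distrib]
  ring

/-- Chebyshev's inequality for the average of independent copies of a random variable. -/
lemma measureReal_average_ge_le {Ω : Type*} [MeasurableSpace Ω] (μ : Measure Ω)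
    [IsProbabilityMeasure μ] {F : Ω → ℝ} (hF : MemLp F 2 μ) {δ : ℝ} (hδ : 0 < δ) {n : ℕ}
    (hn : 0 < n) :
    (Measure.pi fun _ : Fin n => μ).real {u | δ ≤ |1 / (n : ℝ) * ∑ i, F (u i) - ∫ z, F z ∂μ|}
      ≤ Var[F; μ] / δ ^ 2 / n := by
  have hn' : (0 : ℝ) < n := by exact_mod_cast hn
  set P := Measure.pi fun _ : Fin n => μ
  have hFi : ∀ i : Fin n, MemLp (fun u : Fin n → Ω => F (u i)) 2 P := fun i =>
    hF.comp_measurePreserving (measurePreserving_eval (fun _ : Fin n => μ) i)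
  have hS : MemLp (∑ i : Fin n, fun u : Fin n → Ω => F (u i)) 2 P :=
    memLp_finsetSum' _ fun i _ => hFi i
  have hvar : Var[∑ i : Fin n, fun u : Fin n → Ω => F (u i); P] = n * Var[F; μ] := by
    rw [variance_sum_pi (fun _ => hF)]
    simp
  have hmean : ∫ u, (∑ i : Fin n, fun u : Fin n → Ω => F (u i)) u ∂P = n * ∫ z, F z ∂μ := by
    simp only [Finset.sum_apply]
    rw [integral_finsetSum _ fun i _ => (hFi i).integrable one_le_two]
    have : ∀ i : Fin n, ∫ u, F (u i) ∂P = ∫ z, F z ∂μ := fun i => by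
      have hm := measurePreserving_eval (fun _ : Fin n => μ) i
      conv_rhs => rw [← hm.map_eq]
      rw [integral_map hm.measurable.aemeasurable]
      · rw [hm.map_eq]; exact hF.aestronglyMeasurable
    simp [this]
  have h := meas_ge_le_variance_div_sq hS (c := n * δ) (by positivity)
  rw [hvar, hmean] at h
  have hset : {u : Fin n → Ω | δ ≤ |1 / (n : ℝ) * ∑ i, F (u i) - ∫ z, F z ∂μ|}
      = {u | n * δ ≤ |(∑ i : Fin n, fun u : Fin n → Ω => F (u i)) u - n * ∫ z, F z ∂μ|} := by
    ext u
    simp only [Set.mem_ofPred_eq, Finset.sum_apply]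
    rw [show (∑ i, F (u i)) - n * ∫ z, F z ∂μ
      = n * (1 / (n : ℝ) * ∑ i, F (u i) - ∫ z, F z ∂μ) by field_simp, abs_mul, abs_of_pos hn']
    exact (mul_le_mul_iff_right₀ hn').symm
  rw [hset, measureReal_def]
  refine ENNReal.toReal_le_of_le_ofReal ?_ (h.trans_eq ?_)
  · have := variance_nonneg F μ
    positivity
  · congr 1
    field_simp

/-- A codeword and the corresponding channel output are jointly typical with high probability. -/
lemma exists_measureReal_not_jointlyTypical_le (s : ℝ) {v : ℝ≥0} (hv : v ≠ 0) {δ : ℝ}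
    (hδ : 0 < δ) :
    ∃ K : ℝ, ∀ n : ℕ, 0 < n → (Measure.pi fun _ : Fin n => symbolNoiseLaw v).real
      {u | ¬ JointlyTypical (awgnDensity s v) δ (fun i => (u i).1)
        (fun i => s * (u i).1 + (u i).2)} ≤ K / n := by
  have hv' : (0 : ℝ) < v := by positivity
  have hT : (0 : ℝ) < s ^ 2 + v := by positivity
  set T := awgnOutVar s v with hTdef
  have hT0 : T ≠ 0 := awgnOutVar_ne_zero s hv
  set F₁ : ℝ × ℝ → ℝ := fun z => -Real.logb 2 (gaussianPDFReal 0 1 z.1) with hF₁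
  set F₂ : ℝ × ℝ → ℝ := fun z => -Real.logb 2 (gaussianPDFReal 0 T (s * z.1 + z.2)) with hF₂
  set F₃ : ℝ × ℝ → ℝ := fun z => -Real.logb 2 (awgnDensity s v z.1 (s * z.1 + z.2)) with hF₃
  have e₁ : F₁ = fun z => 1 / 2 * Real.logb 2 (2 * Real.pi)
      + (1 / (2 * Real.log 2) * z.1 ^ 2 + (0 * z.2 ^ 2 + 0 * (z.1 * z.2))) := by
    ext z
    simp only [hF₁, logb_gaussianPDFReal _ one_ne_zero, NNReal.coe_one]
    ring_nf
  have e₂ : F₂ = fun z => 1 / 2 * Real.logb 2 (2 * Real.pi * T)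
      + (s ^ 2 / (2 * T * Real.log 2) * z.1 ^ 2 + (1 / (2 * T * Real.log 2) * z.2 ^ 2
        + 2 * s / (2 * T * Real.log 2) * (z.1 * z.2))) := by
    ext z
    simp only [hF₂, logb_gaussianPDFReal _ hT0]
    ring
  have e₃ : F₃ = fun z => (1 / 2 * Real.logb 2 (2 * Real.pi)
      + 1 / 2 * Real.logb 2 (2 * Real.pi * v)) + (1 / (2 * Real.log 2) * z.1 ^ 2
        + (1 / (2 * v * Real.log 2) * z.2 ^ 2 + 0 * (z.1 * z.2))) := by
    ext z
    simp only [hF₃, neg_logb_awgnDensity s hv]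
    ring
  have m₁ : MemLp F₁ 2 (symbolNoiseLaw v) := e₁ ▸ memLp_quadratic v _ _ _ _
  have m₂ : MemLp F₂ 2 (symbolNoiseLaw v) := e₂ ▸ memLp_quadratic v _ _ _ _
  have m₃ : MemLp F₃ 2 (symbolNoiseLaw v) := e₃ ▸ memLp_quadratic v _ _ _ _
  have i₁ : ∫ z, F₁ z ∂(symbolNoiseLaw v) = diffEntropyBits (gaussianPDFReal 0 1) := by
    rw [e₁, integral_quadratic, diffEntropyBits_gaussianPDFReal one_ne_zero]
    simp
  have i₂ : ∫ z, F₂ z ∂(symbolNoiseLaw v) = diffEntropyBits (gaussianPDFReal 0 T) := by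
    rw [e₂, integral_quadratic, diffEntropyBits_gaussianPDFReal hT0, hTdef, coe_awgnOutVar]
    have := Real.log_pos one_lt_two
    field_simp
    ring
  have i₃ : ∫ z, F₃ z ∂(symbolNoiseLaw v)
      = diffEntropyBits (fun z : ℝ × ℝ => awgnDensity s v z.1 z.2) := by
    rw [e₃, integral_quadratic, diffEntropyBits_awgnDensity s hv]
    have := Real.log_pos one_lt_two
    field_simp
    ring
  refine ⟨Var[F₁; symbolNoiseLaw v] / δ ^ 2 + Var[F₂; symbolNoiseLaw v] / δ ^ 2
    + Var[F₃; symbolNoiseLaw v] / δ ^ 2, fun n hn => ?_⟩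
  have hsub : {u : Fin n → ℝ × ℝ | ¬ JointlyTypical (awgnDensity s v) δ (fun i => (u i).1)
      (fun i => s * (u i).1 + (u i).2)} ⊆
      ({u | δ ≤ |1 / (n : ℝ) * ∑ i, F₁ (u i) - ∫ z, F₁ z ∂(symbolNoiseLaw v)|}
      ∪ {u | δ ≤ |1 / (n : ℝ) * ∑ i, F₂ (u i) - ∫ z, F₂ z ∂(symbolNoiseLaw v)|})
      ∪ {u | δ ≤ |1 / (n : ℝ) * ∑ i, F₃ (u i) - ∫ z, F₃ z ∂(symbolNoiseLaw v)|} := by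
    intro u hu
    by_contra hcon
    simp only [Set.mem_union, Set.mem_ofPred_eq, not_or, not_le] at hcon
    refine hu ?_
    rw [JointlyTypical, margFst_awgnDensity s hv, margSnd_awgnDensity s hv,
      neg_inv_mul_logb_prod _ fun i => (gaussianPDFReal_pos _ _ _ one_ne_zero).ne',
      neg_inv_mul_logb_prod _ fun i => (gaussianPDFReal_pos _ _ _ hT0).ne',
      neg_inv_mul_logb_prod _ fun i => (awgnDensity_pos s hv _ _).ne', ← i₁, ← i₂, ← i₃]
    exact ⟨hcon.1.1, hcon.1.2, hcon.2⟩
  refine (measureReal_mono hsub).trans ((measureReal_union_le _ _).trans ?_)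
  rw [add_div, add_div]
  exact add_le_add ((measureReal_union_le _ _).trans (add_le_add
    (measureReal_average_ge_le _ m₁ hδ hn) (measureReal_average_ge_le _ m₂ hδ hn)))
    (measureReal_average_ge_le _ m₃ hδ hn)

/-- A random codeword is jointly typical with a given word with small probability. -/
lemma measureReal_jointlyTypical_le (s : ℝ) {v : ℝ≥0} (hv : v ≠ 0) (δ : ℝ) {n : ℕ} (hn : 0 < n)
    (y : Fin n → ℝ) :
    (Measure.pi fun _ : Fin n => gaussianReal 0 1).real
      {x | JointlyTypical (awgnDensity s v) δ x y}
      ≤ 2 ^ (-(n * (1 / 2 * Real.logb 2 (1 + s ^ 2 / v) - 3 * δ))) := by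
  have hn' : (0 : ℝ) < n := by exact_mod_cast hn
  set T := awgnOutVar s v with hTdef
  have hT0 : T ≠ 0 := awgnOutVar_ne_zero s hv
  -- The likelihood ratio `f(y | x) / f_Y(y)`. Joint typicality forces its product over the symbols
  -- to be at least `2 ^ (n (I - 3δ))`, while that product has mean one for every fixed `y`;
  -- Markov's inequality concludes.
  set r : ℝ → ℝ → ℝ := fun y x => gaussianPDFReal (s * x) v y / gaussianPDFReal 0 T y with hr
  have hr0 : ∀ y x, 0 < r y x := fun y x =>
    div_pos (gaussianPDFReal_pos _ _ _ hv) (gaussianPDFReal_pos _ _ _ hT0)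
  have hrint : ∀ y, Integrable (r y) (gaussianReal 0 1) := fun y => by
    have hm : Measurable (r y) := by simp only [hr, gaussianPDFReal]; fun_prop
    refine Integrable.of_bound hm.aestronglyMeasurable
      ((√(2 * Real.pi * v))⁻¹ / gaussianPDFReal 0 T y) (ae_of_all _ fun x => ?_)
    rw [Real.norm_of_nonneg (hr0 y x).le]
    refine div_le_div_of_nonneg_right ?_ (gaussianPDFReal_nonneg _ _ _)
    refine mul_le_of_le_one_right (by positivity) (Real.exp_le_one_iff.2 ?_)
    exact div_nonpos_of_nonpos_of_nonneg (neg_nonpos.2 (sq_nonneg _)) (by positivity)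
  have hr1 : ∀ y, ∫ x, r y x ∂(gaussianReal 0 1) = 1 := fun y => by
    rw [integral_gaussianReal_eq_integral_smul one_ne_zero]
    have e : ∀ x, gaussianPDFReal 0 1 x • r y x
        = gaussianPDFReal (s * y / T) (v / T) x := fun x => by
      have h := awgnDensity_eq s hv x y
      rw [awgnDensity] at h
      simp only [hr, smul_eq_mul]
      rw [← mul_div_assoc, h, mul_div_cancel_left₀ _ (gaussianPDFReal_pos _ _ _ hT0).ne']
    simp only [e]
    exact integral_gaussianPDFReal_eq_one _ (div_ne_zero hv hT0)
  set I := 1 / 2 * Real.logb 2 (1 + s ^ 2 / v) with hI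
  have hsub : {x | JointlyTypical (awgnDensity s v) δ x y}
      ⊆ {x : Fin n → ℝ | (2 : ℝ) ^ (n * (I - 3 * δ)) ≤ ∏ i, r (y i) (x i)} := by
    rintro x ⟨h1, h2, h3⟩
    rw [margFst_awgnDensity s hv,
      neg_inv_mul_logb_prod _ fun i => (gaussianPDFReal_pos _ _ _ one_ne_zero).ne'] at h1
    rw [margSnd_awgnDensity s hv,
      neg_inv_mul_logb_prod _ fun i => (gaussianPDFReal_pos _ _ _ hT0).ne'] at h2
    rw [neg_inv_mul_logb_prod _ fun i => (awgnDensity_pos s hv _ _).ne'] at h3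
    have hprod : 0 < ∏ i, r (y i) (x i) := Finset.prod_pos fun i _ => hr0 _ _
    refine (Real.le_logb_iff_rpow_le one_lt_two hprod).1 ?_
    have e : Real.logb 2 (∏ i, r (y i) (x i)) = (∑ i, -Real.logb 2 (gaussianPDFReal 0 1 (x i)))
        + (∑ i, -Real.logb 2 (gaussianPDFReal 0 T (y i)))
        - ∑ i, -Real.logb 2 (awgnDensity s v (x i) (y i)) := by
      rw [Real.logb_prod _ _ fun i _ => (hr0 _ _).ne', ← Finset.sum_add_distrib,
        ← Finset.sum_sub_distrib]
      refine Finset.sum_congr rfl fun i _ => ?_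
      simp only [hr, awgnDensity]
      rw [Real.logb_div (gaussianPDFReal_pos _ _ _ hv).ne' (gaussianPDFReal_pos _ _ _ hT0).ne',
        Real.logb_mul (gaussianPDFReal_pos _ _ _ one_ne_zero).ne'
          (gaussianPDFReal_pos _ _ _ hv).ne']
      ring
    have hk := diffEntropyBits_add_sub s hv
    rw [e]
    have k1 := (abs_lt.1 h1).1
    have k2 := (abs_lt.1 h2).1
    have k3 := (abs_lt.1 h3).2
    -- Each of the three empirical entropies in `h(X) + h(Y) - h(X, Y)` costs one `δ`.
    have key : I - 3 * δ ≤ 1 / (n : ℝ) * ((∑ i, -Real.logb 2 (gaussianPDFReal 0 1 (x i)))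
        + (∑ i, -Real.logb 2 (gaussianPDFReal 0 T (y i)))
        - ∑ i, -Real.logb 2 (awgnDensity s v (x i) (y i))) := by
      rw [mul_sub, mul_add]
      linarith
    have := mul_le_mul_of_nonneg_left key hn'.le
    rwa [← mul_assoc, mul_one_div_cancel hn'.ne', one_mul] at this
  have hpos : (0 : ℝ) < 2 ^ (n * (I - 3 * δ)) := Real.rpow_pos_of_pos two_pos _
  have hmk := mul_meas_ge_le_integral_of_nonneg
    (μ := Measure.pi fun _ : Fin n => gaussianReal 0 1) (f := fun x => ∏ i, r (y i) (x i))
    (ae_of_all _ fun x => Finset.prod_nonneg fun i _ => (hr0 _ _).le)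
    (Integrable.fintype_prod fun i => hrint (y i)) (2 ^ (n * (I - 3 * δ)))
  rw [integral_fintype_prod_eq_prod (fun i => r (y i))] at hmk
  simp only [hr1, Finset.prod_const_one] at hmk
  refine (measureReal_mono hsub).trans ?_
  rw [Real.rpow_neg two_pos.le, ← one_div, le_div_iff₀ hpos, mul_comm]
  exact hmk

lemma measurableSet_jointlyTypical (s : ℝ) {v : ℝ≥0} (hv : v ≠ 0) (δ : ℝ) (n : ℕ) :
    MeasurableSet {p : (Fin n → ℝ) × (Fin n → ℝ) |
      JointlyTypical (awgnDensity s v) δ p.1 p.2} := by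
  have hm := measurable_awgnDensity s v
  have h3 : ∀ i, Measurable fun p : (Fin n → ℝ) × (Fin n → ℝ) =>
      awgnDensity s v (p.1 i) (p.2 i) := fun i =>
    hm.comp (f := fun p : (Fin n → ℝ) × (Fin n → ℝ) => (p.1 i, p.2 i)) (by fun_prop)
  have h1 := measurable_gaussianPDFReal 0 1
  have h2 := measurable_gaussianPDFReal 0 (awgnOutVar s v)
  simp only [JointlyTypical, margFst_awgnDensity s hv, margSnd_awgnDensity s hv, Real.logb,
    Set.ofPred_and]
  refine MeasurableSet.inter (measurableSet_lt ?_ measurable_const)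
    (MeasurableSet.inter (measurableSet_lt ?_ measurable_const)
      (measurableSet_lt ?_ measurable_const)) <;> fun_prop

/-! ### Independent coordinates -/

lemma measurePreserving_pi_comp {ι ι' Ω : Type*} [Fintype ι] [Fintype ι'] [MeasurableSpace Ω]
    (μ : Measure Ω) [IsProbabilityMeasure μ] {e : ι' → ι} (he : Function.Injective e) :
    MeasurePreserving (fun (z : ι → Ω) (j : ι') => z (e j)) (Measure.pi fun _ => μ)
      (Measure.pi fun _ => μ) := by
  refine ⟨by fun_prop, ?_⟩
  have h : iIndepFun (fun (i : ι) (z : ι → Ω) => z i) (Measure.pi fun _ => μ) :=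
    iIndepFun_pi (X := fun _ => id) fun _ => aemeasurable_id
  rw [(h.precomp he).map_fun_eq_pi_map fun j => (measurable_pi_apply _).aemeasurable]
  congr 1
  ext1 j
  exact (measurePreserving_eval (fun _ : ι => μ) (e j)).map_eq

lemma measurePreserving_pi_pair {ι Ω : Type*} [Fintype ι] [MeasurableSpace Ω]
    (μ : Measure Ω) [IsProbabilityMeasure μ] {i j : ι} (hij : i ≠ j) :
    MeasurePreserving (fun z : ι → Ω => (z i, z j)) (Measure.pi fun _ => μ) (μ.prod μ) := by
  refine ⟨by fun_prop, ?_⟩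
  have h : iIndepFun (fun (i : ι) (z : ι → Ω) => z i) (Measure.pi fun _ => μ) :=
    iIndepFun_pi (X := fun _ => id) fun _ => aemeasurable_id
  rw [(h.indepFun hij).map_prod_eq_prod_map_map (measurable_pi_apply i).aemeasurable
    (measurable_pi_apply j).aemeasurable]
  congr 1
  · exact (measurePreserving_eval (fun _ : ι => μ) i).map_eq
  · exact (measurePreserving_eval (fun _ : ι => μ) j).map_eq

/-! ### Error probability of the typical decoder -/

lemma typicalDecoder_eq_some {f : ℝ → ℝ → ℝ} {δ : ℝ} {M : Type*} {n : ℕ} {c : M → Fin n → ℝ}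
    {y : Fin n → ℝ} {w : M} (hw : JointlyTypical f δ (c w) y)
    (h : ∀ w', w' ≠ w → ¬ JointlyTypical f δ (c w') y) : typicalDecoder f δ c y = some w := by
  have hu : ∀ w', JointlyTypical f δ (c w') y → w' = w := fun w' hw' =>
    by_contra fun hne => h w' hne hw'
  have hex : ∃! w, JointlyTypical f δ (c w) y := ⟨w, hw, hu⟩
  rw [typicalDecoder, dif_pos hex]
  exact congrArg some (hu _ hex.choose_spec.1)

instance (M : Type*) [Fintype M] (n : ℕ) : IsProbabilityMeasure (codebookLaw M n) := by
  unfold codebookLaw; infer_instance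

instance (α σR2 : ℝ≥0) (k n : ℕ) (M : Type*) [Fintype M] :
    IsProbabilityMeasure (firstSlotLaw α σR2 k n M) := by
  unfold firstSlotLaw; infer_instance

lemma relayReceived_firstSlot (α : ℝ≥0) (xth : ℝ) {k n : ℕ} (hn : n ≤ k) (x : Fin n → ℝ)
    (g z : Fin k → ℝ) (j : Fin n) :
    relayReceived (firstSlotSource α xth k x) (firstSlotRelay k) g z (Fin.castLE hn j)
      = √(sourcePower α xth 0) * x j + z (Fin.castLE hn j) := by
  simp [relayReceived, firstSlotSource, firstSlotRelay]

section ErrorProb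

variable (α : ℝ≥0) {σR2 : ℝ≥0} (xth δ : ℝ) {k n : ℕ} (hn : n ≤ k) {M : Type*} [Fintype M]

/-- Regroups the sent codeword and the first `n` noise samples into independent identically
distributed pairs, the setting of the Chebyshev bound. -/
lemma measurePreserving_sent (w : M) :
    MeasurePreserving (fun ω : (M → Fin n → ℝ) × (Fin k → ℝ) × (Fin k → ℝ) =>
        fun j : Fin n => (ω.1 w j, ω.2.2 (Fin.castLE hn j)))
      (firstSlotLaw α σR2 k n M) (Measure.pi fun _ => symbolNoiseLaw σR2) := by
  have h1 : MeasurePreserving (fun c : M → Fin n → ℝ => c w) (codebookLaw M n)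
      (Measure.pi fun _ => gaussianReal 0 1) :=
    measurePreserving_eval (fun _ : M => Measure.pi fun _ : Fin n => gaussianReal 0 1) w
  have h2 : MeasurePreserving (fun z : (Fin k → ℝ) × (Fin k → ℝ) =>
      fun j : Fin n => z.2 (Fin.castLE hn j))
      ((Measure.pi fun _ : Fin k => gaussianReal 0 α).prod
        (Measure.pi fun _ : Fin k => gaussianReal 0 σR2))
      (Measure.pi fun _ : Fin n => gaussianReal 0 σR2) :=
    (measurePreserving_pi_comp (gaussianReal 0 σR2) (Fin.castLE_injective hn)).comp
      measurePreserving_snd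
  have h3 := (measurePreserving_arrowProdEquivProdArrow ℝ ℝ (Fin n)
    (fun _ => gaussianReal 0 1) (fun _ => gaussianReal 0 σR2)).symm
  exact h3.comp (h1.prod h2)

/-- A wrong codeword is independent of the sent codeword and the noise, so by Fubini the received
word may be frozen and the fixed-word bound applied. -/
lemma measureReal_other_typical_le (hσ : σR2 ≠ 0) (hn0 : 0 < n) {w w' : M} (hne : w' ≠ w) :
    (firstSlotLaw α σR2 k n M).real {ω | JointlyTypical (firstSlotDensity α σR2 xth) δ (ω.1 w')
      (fun j => √(sourcePower α xth 0) * ω.1 w j + ω.2.2 (Fin.castLE hn j))}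
      ≤ 2 ^ (-(n * (1 / 2 * Real.logb 2 (1 + √(sourcePower α xth 0) ^ 2 / σR2) - 3 * δ))) := by
  set s := √(sourcePower α xth 0)
  set N := Measure.pi fun _ : Fin n => gaussianReal 0 1
  set L := (Measure.pi fun _ : Fin k => gaussianReal 0 α).prod
        (Measure.pi fun _ : Fin k => gaussianReal 0 σR2)
  have h1 : MeasurePreserving (fun c : M → Fin n → ℝ => (c w', c w)) (codebookLaw M n)
      (N.prod N) := measurePreserving_pi_pair N hne
  have h2 : MeasurePreserving (fun ω : (M → Fin n → ℝ) × (Fin k → ℝ) × (Fin k → ℝ) =>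
      (ω.1 w', (ω.1 w, ω.2))) (firstSlotLaw α σR2 k n M) (N.prod (N.prod L)) :=
    (measurePreserving_prodAssoc N N L).comp (h1.prod (MeasurePreserving.id L))
  set S : Set ((Fin n → ℝ) × (Fin n → ℝ) × (Fin k → ℝ) × (Fin k → ℝ)) :=
    {p | JointlyTypical (awgnDensity s σR2) δ p.1
      (fun j => s * p.2.1 j + p.2.2.2 (Fin.castLE hn j))} with hS
  have hSm : MeasurableSet S := (measurableSet_jointlyTypical s hσ δ n).preimage
    (f := fun p : (Fin n → ℝ) × (Fin n → ℝ) × (Fin k → ℝ) × (Fin k → ℝ) =>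
      (p.1, fun j => s * p.2.1 j + p.2.2.2 (Fin.castLE hn j))) (by fun_prop)
  set b : ℝ := 2 ^ (-(n * (1 / 2 * Real.logb 2 (1 + s ^ 2 / σR2) - 3 * δ))) with hb
  have hb0 : 0 ≤ b := Real.rpow_nonneg two_pos.le _
  have h3 : (N.prod (N.prod L)) S ≤ ENNReal.ofReal b := by
    rw [Measure.prod_apply_symm hSm]
    refine (lintegral_mono (g := fun _ => ENNReal.ofReal b) fun q => ?_).trans (by simp)
    rw [← ofReal_measureReal]
    exact ENNReal.ofReal_le_ofReal (measureReal_jointlyTypical_le s hσ δ hn0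
      (fun j => s * q.1 j + q.2.2 (Fin.castLE hn j)))
  refine ENNReal.toReal_le_of_le_ofReal hb0 (le_trans (le_of_eq ?_) h3)
  exact h2.measure_preimage hSm.nullMeasurableSet

lemma firstSlotErrorProb_le (hσ : σR2 ≠ 0) {K : ℝ}
    (hK : ∀ n : ℕ, 0 < n → (Measure.pi fun _ : Fin n => symbolNoiseLaw σR2).real
      {u | ¬ JointlyTypical (awgnDensity (√(sourcePower α xth 0)) σR2) δ (fun i => (u i).1)
        (fun i => √(sourcePower α xth 0) * (u i).1 + (u i).2)} ≤ K / n)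
    (hn0 : 0 < n) [Nonempty M] :
    firstSlotErrorProb α σR2 xth δ hn M ≤ K / n + Fintype.card M *
      2 ^ (-(n * (1 / 2 * Real.logb 2 (1 + √(sourcePower α xth 0) ^ 2 / σR2) - 3 * δ))) := by
  classical
  set s := √(sourcePower α xth 0) with hs
  set b : ℝ := 2 ^ (-(n * (1 / 2 * Real.logb 2 (1 + s ^ 2 / σR2) - 3 * δ))) with hb
  have hb0 : 0 ≤ b := Real.rpow_nonneg two_pos.le _
  set P := firstSlotLaw α σR2 k n M
  have hw : ∀ w : M, P.real (firstSlotError α σR2 xth δ hn w) ≤ K / n + Fintype.card M * b := by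
    intro w
    set A : Set ((M → Fin n → ℝ) × (Fin k → ℝ) × (Fin k → ℝ)) :=
      {ω | ¬ JointlyTypical (awgnDensity s σR2) δ (ω.1 w)
        (fun j => s * ω.1 w j + ω.2.2 (Fin.castLE hn j))} with hA
    set B : M → Set ((M → Fin n → ℝ) × (Fin k → ℝ) × (Fin k → ℝ)) := fun w' =>
      {ω | JointlyTypical (firstSlotDensity α σR2 xth) δ (ω.1 w')
        (fun j => s * ω.1 w j + ω.2.2 (Fin.castLE hn j))} with hB
    -- An error requires that the sent codeword is atypical (`A`) or that some other codeword is
    -- typical (`B w'`).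
    have hsub : firstSlotError α σR2 xth δ hn w
        ⊆ A ∪ ⋃ w' ∈ Finset.univ.erase w, B w' := by
      intro ω hω
      by_contra hcon
      simp only [Set.mem_union, Set.mem_iUnion, not_or, not_exists, Finset.mem_erase,
        Finset.mem_univ, and_true] at hcon
      refine hω ?_
      simp only [relayReceived_firstSlot]
      exact typicalDecoder_eq_some (not_not.1 hcon.1) hcon.2
    have hAm : P.real A ≤ K / n := by
      have hmp := measurePreserving_sent α (σR2 := σR2) hn w
      have hset : MeasurableSet {u : Fin n → ℝ × ℝ | ¬ JointlyTypical (awgnDensity s σR2) δ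
          (fun i => (u i).1) (fun i => s * (u i).1 + (u i).2)} :=
        ((measurableSet_jointlyTypical s hσ δ n).preimage
          (f := fun u : Fin n → ℝ × ℝ =>
            (fun i => (u i).1, fun i => s * (u i).1 + (u i).2)) (by fun_prop)).compl
      refine le_trans (le_of_eq ?_) (hK n hn0)
      rw [measureReal_def, measureReal_def, ← hmp.measure_preimage hset.nullMeasurableSet]
      rfl
    have hBm : P.real (⋃ w' ∈ Finset.univ.erase w, B w') ≤ Fintype.card M * b := by
      refine (measureReal_biUnion_finset_le _ _).trans ((Finset.sum_le_card_nsmul _ _ b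
        fun w' hw' => ?_).trans ?_)
      · exact measureReal_other_typical_le α xth δ hn hσ hn0 (Finset.ne_of_mem_erase hw')
      · rw [nsmul_eq_mul]
        refine mul_le_mul_of_nonneg_right ?_ hb0
        exact_mod_cast Finset.card_le_univ _
    exact (measureReal_mono hsub).trans ((measureReal_union_le _ _).trans (add_le_add hAm hBm))
  have hcard : (0 : ℝ) < Fintype.card M := by exact_mod_cast Fintype.card_pos
  rw [firstSlotErrorProb, div_le_iff₀ hcard]
  refine (Finset.sum_le_card_nsmul _ _ _ fun w _ => hw w).trans_eq ?_
  rw [nsmul_eq_mul, mul_comm, Finset.card_univ]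

end ErrorProb

/-! ### Achievability -/

/-- Using `max R 0` covers nonpositive rates, for which the natural-number ceiling is zero. -/
lemma tendsto_two_pow_mul_two_rpow {R p a : ℝ} (ha : 0 < a) (h : max R 0 < p * a) {n : ℕ → ℕ}
    (hn : ∀ k : ℕ, k * p - 1 ≤ n k) :
    Tendsto (fun k : ℕ => (2 : ℝ) ^ ⌈(k : ℝ) * R⌉₊ * 2 ^ (-(n k * a))) atTop (𝓝 0) := by
  -- In the constant `1 + a`, the `1` pays for rounding up the number of bits and the `a` for
  -- rounding down the block length.
  have hlim : Tendsto (fun k : ℕ => (2 : ℝ) ^ ((k : ℝ) * (max R 0 - p * a) + (1 + a)))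
      atTop (𝓝 0) := by
    refine (tendsto_rpow_atBot_of_base_gt_one 2 one_lt_two).comp ?_
    exact tendsto_atBot_add_const_right _ _
      (tendsto_natCast_atTop_atTop.atTop_mul_const_of_neg (sub_neg.2 h))
  refine squeeze_zero (fun k => by positivity) (fun k => ?_) hlim
  rw [← Real.rpow_natCast, ← Real.rpow_add two_pos]
  refine Real.rpow_le_rpow_of_exponent_le one_le_two ?_
  have h1 : (⌈(k : ℝ) * R⌉₊ : ℝ) ≤ k * max R 0 + 1 := by
    have h2 : ⌈(k : ℝ) * R⌉₊ ≤ ⌈(k : ℝ) * max R 0⌉₊ :=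
      Nat.ceil_mono (mul_le_mul_of_nonneg_left (le_max_left _ _) k.cast_nonneg)
    have h3 := Nat.ceil_lt_add_one (mul_nonneg (Nat.cast_nonneg (α := ℝ) k) (le_max_right R 0))
    have h2' : (⌈(k : ℝ) * R⌉₊ : ℝ) ≤ ⌈(k : ℝ) * max R 0⌉₊ := by exact_mod_cast h2
    linarith
  have h4 := mul_le_mul_of_nonneg_right (hn k) ha.le
  linarith

lemma tendsto_firstSlotErrorProb {α σR2 : ℝ≥0} (hα : 0 < α) (hσR : 0 < σR2)
    (ν : Measure ℝ) [IsProbabilityMeasure ν] {xth : ℝ} (hxth : 0 < xth)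
    (hp : 0 < transmitProb ν xth) {R : ℝ}
    (hR : R < 1 / 2 * Real.logb 2 (1 + α * xth ^ 2 / σR2) * transmitProb ν xth) :
    ∃ δ₀ : ℝ, 0 < δ₀ ∧ ∀ δ : ℝ, 0 < δ → δ < δ₀ →
      Tendsto
        (fun k : ℕ =>
          firstSlotErrorProb α σR2 xth δ (blockLength_le ν xth k) (Message k R))
        atTop (𝓝 0) := by
  set I := 1 / 2 * Real.logb 2 (1 + α * xth ^ 2 / σR2) with hI
  set p := transmitProb ν xth with hpdef
  have hI0 : 0 < I := by
    have hα' : (0 : ℝ) < α := hα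
    have hσ' : (0 : ℝ) < σR2 := hσR
    have : (0 : ℝ) < α * xth ^ 2 / σR2 := by positivity
    exact mul_pos (by norm_num) (Real.logb_pos one_lt_two (by linarith))
  have hmax : max R 0 < I * p := max_lt hR (mul_pos hI0 hp)
  -- Chosen so that `max R 0 < p (I - 3δ)` for all smaller `δ`: the loss `3δ` stays below the rate
  -- gap per codeword symbol.
  refine ⟨(I - max R 0 / p) / 3, ?_, fun δ hδ hδ₀ => ?_⟩
  · have := (div_lt_iff₀ hp).2 hmax
    linarith
  have hmax' : max R 0 / p < I - 3 * δ := by linarith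
  have ha : 0 < I - 3 * δ := (div_nonneg (le_max_right _ _) hp.le).trans_lt hmax'
  have hpa : max R 0 < p * (I - 3 * δ) := by rwa [div_lt_iff₀' hp] at hmax'
  have hs : 1 / 2 * Real.logb 2 (1 + √(sourcePower α xth 0) ^ 2 / σR2) = I := by
    rw [Real.sq_sqrt (sourcePower_nonneg _ _ _), sourcePower_zero]
  obtain ⟨K, hK⟩ := exists_measureReal_not_jointlyTypical_le (√(sourcePower α xth 0)) hσR.ne' hδ
  have hbl : ∀ k : ℕ, (k : ℝ) * p - 1 ≤ blockLength ν xth k := fun k =>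
    (Nat.sub_one_lt_floor _).le
  have hbl' : Tendsto (fun k : ℕ => (blockLength ν xth k : ℝ)) atTop atTop :=
    tendsto_atTop_mono hbl (tendsto_atTop_add_const_right _ (-1)
      (tendsto_natCast_atTop_atTop.atTop_mul_const hp))
  have hlim := (hbl'.const_div_atTop K).add (tendsto_two_pow_mul_two_rpow ha hpa hbl)
  rw [add_zero] at hlim
  refine squeeze_zero' (Eventually.of_forall fun k => ?_) ?_ hlim
  · exact div_nonneg (Finset.sum_nonneg fun _ _ => measureReal_nonneg) (Nat.cast_nonneg _)
  -- The error bound needs a nonempty block, which holds only for large `k`.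
  · filter_upwards [hbl'.eventually_gt_atTop 0] with k hk
    have h := firstSlotErrorProb_le α xth δ (blockLength_le ν xth k) hσR.ne' hK
      (by exact_mod_cast hk) (M := Message k R)
    rw [hs] at h
    simpa using h

theorem lemma1 (α σR2 σD2 PS PR : ℝ≥0)
    (hα : 0 < α) (hσR : 0 < σR2) (hσD : 0 < σD2) (hPS : 0 < PS) (hPR : 0 < PR)
    (ν : Measure ℝ) [IsProbabilityMeasure ν]
    (hν : IsOptimalRelayInput α σR2 σD2 PS PR ν)
    (xth : ℝ) (hxth : 0 < xth) (hpow : ∫ x, sourcePower α xth x ∂ν = (PS : ℝ))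
    (R ε : ℝ) (hε : 0 < ε) (hR : R = (relayCapacity α σR2 σD2 PS PR).toReal - ε) :
    relayCapacity α σR2 σD2 PS PR ≠ ∞ ∧
    IsGreatest
      {I : ℝ≥0∞ | ∃ p : Measure ℝ, IsProbabilityMeasure p ∧
        ∫⁻ s, ENNReal.ofReal (s ^ 2) ∂p ≤ ENNReal.ofReal (sourcePower α xth 0) ∧
        I = sourceRelayInfoAt α σR2 0 p}
      (ENNReal.ofReal (1 / 2 * Real.logb 2 (1 + α * xth ^ 2 / σR2))) ∧
    R < 1 / 2 * Real.logb 2 (1 + α * xth ^ 2 / σR2) * transmitProb ν xth ∧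
    ∃ δ₀ : ℝ, 0 < δ₀ ∧ ∀ δ : ℝ, 0 < δ → δ < δ₀ →
      Tendsto
        (fun k : ℕ =>
          firstSlotErrorProb α σR2 xth δ (blockLength_le ν xth k) (Message k R))
        atTop (𝓝 0) := by
  have hlt : R < 1 / 2 * Real.logb 2 (1 + α * xth ^ 2 / σR2) * transmitProb ν xth := by
    have := toReal_relayCapacity_le hσR ν hν hxth hpow
    linarith
  exact ⟨relayCapacity_ne_top α σR2 PS PR hσD, isGreatest_sourceRelayInfoAt_zero α hσR xth, hlt,
    tendsto_firstSlotErrorProb hα hσR ν hxth (transmitProb_pos hPS ν hxth hpow) hlt⟩
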